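/- **Setting.** Let $\mathbb S=\mathrm{Res}_{\mathbb C/\mathbb R}\mathbb G_m$. A Shimura datum $(G,X)$ (in the sense of Deligne) consists of a connected reductive algebraic group $G$ over $\mathbb Q$ and a $G(\mathbb R)$-conjugacy class $X$ of homomorphisms $h:\mathbb S\to G_{\mathbb R}$ such that for $h\in X$: (i) $\mathrm{Ad}\circ h$ induces on $\mathrm{Lie}(G)_{\mathbb C}$ a Hodge structure of type $\{(-1,1),(0,0),(1,-1)\}$; (ii) $\mathrm{ad}\,h(i)$ is a Cartan involution of $G^{ad}_{\mathbb R}$; (iii) $G^{ad}$ has no nontrivial factor over $\mathbb Q$ on which the projection of $h$ is trivial. Here $G^{ad}=G/Z(G)$, where $Z(G)$ is the centre of $G$. For an algebraic group $H$ over $\mathbb Q$ and a homomorphism $y:\mathbb S\to H_{\mathbb R}$, write $y^{ad}:\mathbb S\to H^{ad}_{\mathbb R}$ for its composite with $H_{\mathbb R}\to H^{ad}_{\mathbb R}$. The Mumford–Tate group of $y$ is the smallest algebraic subgroup $M_y\subseteq H$ over $\mathbb Q$ such that $y$ factors through $(M_y)_{\mathbb R}$; for $y\in X$ with $(G,X)$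 a Shimura datum, it is the group of the smallest Shimura subdatum of $(G,X)$ containing $y$. A point $x\in X_M$ of a Shimura datum $(M,X_M)$ is Hodge generic if the Mumford–Tate group of $x^{ad}$ is $M^{ad}$ (equivalently, $M_x$ contains the derived group of $M$; this holds in particular if $M_x=M$). For Shimura data $(M,X_M)$ and $(G,X)$ and a Hodge generic point $x\in X_M$, the hybrid Hecke orbit of $(M,X_M,x)$ in $X$ is $$\Sigma_X(M,X_M,x)=\{x'\in X \mid \exists\, \phi\in \mathrm{Hom}_{\mathbb Q}(M^{ad},M_{x'}^{ad}),\ \phi\circ x^{ad}=x'^{ad}\},$$ where $x'^{ad}$ denotes the composite $\mathbb S\to (M_{x'})_{\mathbb R}\to (M_{x'}^{ad})_{\mathbb R}$ induced by $x'$. **Proposition.** Let $(M,X_M)$, $(G_1,X_1)$ and $(G_2,X_2)$ be Shimura data and let $x\in X_M$ be a Hodge generic point. Then, for the datum $(G_1\times G_2,X_1\times X_2)$, where homomorphisms $\mathbb S\to (G_1\times G_2)_{\mathbb R}$ are identified with pairs of homomorphisms, $$\Sigma_{X_1\times X_2}(M,X_M,x)=\Sigma_{X_1}(M,X_M,x)\times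 \Sigma_{X_2}(M,X_M,x).$$ -/

import Mathlib

open scoped TensorProduct

universe u v w

/-!
Affine group schemes `G` over a field `k` are given by their coordinate rings: commutative Hopf
algebras `A = O(G)` over `k`. Dictionary:
* `G(R)` is `A →ₐ[k] R`, with product the convolution product on `WithConv (A →ₐ[k] R)` and
  inverse `g ↦ g ∘ antipode`;
* homomorphisms `G → H` are bialgebra homomorphisms `O(H) →ₐc[k] O(G)`;
* closed subgroups of `G` are Hopf ideals of `A` (smaller subgroups have larger ideals);
* `G₁ × G₂` is `A₁ ⊗[k] A₂`, and the base change `G_K` is `K ⊗[k] A`.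
-/

noncomputable section
namespace Shimura

/-- The polynomial `a ^ 2 + b ^ 2`. -/
def torusNorm : MvPolynomial (Fin 2) ℝ := MvPolynomial.X 0 ^ 2 + MvPolynomial.X 1 ^ 2

/-- Coordinate ring `ℝ[a, b, (a ^ 2 + b ^ 2)⁻¹]` of the Deligne torus `S = Res_{ℂ/ℝ} 𝔾ₘ`; the point
`(a, b)` is `a + b i`. -/
def DeligneTorus : Type := Localization.Away torusNorm

namespace DeligneTorus

instance : CommRing DeligneTorus := inferInstanceAs (CommRing (Localization.Away torusNorm))
instance : Algebra ℝ DeligneTorus := inferInstanceAs (Algebra ℝ (Localization.Away torusNorm))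
instance : Algebra ℚ DeligneTorus := inferInstanceAs (Algebra ℚ (Localization.Away torusNorm))
instance : IsScalarTower ℚ ℝ DeligneTorus :=
  inferInstanceAs (IsScalarTower ℚ ℝ (Localization.Away torusNorm))
instance : Algebra (MvPolynomial (Fin 2) ℝ) DeligneTorus :=
  inferInstanceAs (Algebra (MvPolynomial (Fin 2) ℝ) (Localization.Away torusNorm))
instance : IsScalarTower ℝ (MvPolynomial (Fin 2) ℝ) DeligneTorus :=
  inferInstanceAs (IsScalarTower ℝ (MvPolynomial (Fin 2) ℝ) (Localization.Away torusNorm))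
instance : IsLocalization.Away torusNorm DeligneTorus :=
  inferInstanceAs (IsLocalization.Away torusNorm (Localization.Away torusNorm))

/-- The coordinate function `a`. -/
def re : DeligneTorus := algebraMap (MvPolynomial (Fin 2) ℝ) DeligneTorus (MvPolynomial.X 0)
/-- The coordinate function `b`. -/
def im : DeligneTorus := algebraMap (MvPolynomial (Fin 2) ℝ) DeligneTorus (MvPolynomial.X 1)

lemma isUnit_norm : IsUnit (re ^ 2 + im ^ 2) := by
  have h := IsLocalization.Away.algebraMap_isUnit (S := DeligneTorus) torusNorm
  simpa [torusNorm, re, im] using h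

section lift
variable {R : Type*} [CommRing R] [Algebra ℝ R]

/-- The point `a + b i` of `S` with values in `R`. -/
def lift (a b : R) (hab : IsUnit (a ^ 2 + b ^ 2)) : DeligneTorus →ₐ[ℝ] R :=
  IsLocalization.liftAlgHom (M := Submonoid.powers torusNorm)
    (f := MvPolynomial.aeval ![a, b]) (by
      rintro ⟨_, n, rfl⟩
      simpa [torusNorm] using hab.pow n)

@[simp] lemma lift_re (a b : R) (hab : IsUnit (a ^ 2 + b ^ 2)) : lift a b hab re = a := by
  simp [lift, re]

@[simp] lemma lift_im (a b : R) (hab : IsUnit (a ^ 2 + b ^ 2)) : lift a b hab im = b := by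
  simp [lift, im]

lemma algHom_ext {f g : DeligneTorus →ₐ[ℝ] R} (h₁ : f re = g re) (h₂ : f im = g im) : f = g := by
  refine IsLocalization.algHom_ext (Submonoid.powers torusNorm) ?_
  refine MvPolynomial.algHom_ext fun i => ?_
  fin_cases i
  · exact h₁
  · exact h₂

end lift

/-- The function `(a ^ 2 + b ^ 2)⁻¹`. -/
def inv : DeligneTorus := ↑(isUnit_norm.unit⁻¹)

lemma norm_mul_inv : (re ^ 2 + im ^ 2) * inv = 1 := isUnit_norm.mul_val_inv

lemma isUnit_norm_mul : IsUnit ((re ⊗ₜ[ℝ] re - im ⊗ₜ[ℝ] im) ^ 2 +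
    (re ⊗ₜ[ℝ] im + im ⊗ₜ[ℝ] re) ^ 2) := by
  have h : (re ⊗ₜ[ℝ] re - im ⊗ₜ[ℝ] im) ^ 2 + (re ⊗ₜ[ℝ] im + im ⊗ₜ[ℝ] re) ^ 2 =
      (re ^ 2 + im ^ 2) ⊗ₜ[ℝ] (re ^ 2 + im ^ 2) := by
    simp only [sub_eq_add_neg, pow_two, mul_add, add_mul, TensorProduct.add_tmul,
      TensorProduct.tmul_add, Algebra.TensorProduct.tmul_mul_tmul, neg_mul, mul_neg,
      mul_comm im re]
    abel
  rw [h]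
  refine .of_mul_eq_one (inv ⊗ₜ inv) ?_
  rw [Algebra.TensorProduct.tmul_mul_tmul, norm_mul_inv, Algebra.TensorProduct.one_def]

/-- The multiplication `(a + b i) (c + d i) = (a c - b d) + (a d + b c) i` and the unit `1`. -/
instance : Bialgebra ℝ DeligneTorus :=
  .ofAlgHom
    (lift (re ⊗ₜ[ℝ] re - im ⊗ₜ[ℝ] im) (re ⊗ₜ[ℝ] im + im ⊗ₜ[ℝ] re) isUnit_norm_mul)
    (lift 1 0 (by simp))
    (by
      apply algHom_ext <;>
      simp [TensorProduct.add_tmul, TensorProduct.tmul_add, TensorProduct.sub_tmul,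
        TensorProduct.tmul_sub] <;> abel)
    (by apply algHom_ext <;> simp [sub_eq_add_neg])
    (by apply algHom_ext <;> simp [sub_eq_add_neg])

@[simp] lemma comul_re : Coalgebra.comul (R := ℝ) re = re ⊗ₜ[ℝ] re - im ⊗ₜ[ℝ] im :=
  lift_re _ _ isUnit_norm_mul
@[simp] lemma comul_im : Coalgebra.comul (R := ℝ) im = re ⊗ₜ[ℝ] im + im ⊗ₜ[ℝ] re :=
  lift_im _ _ isUnit_norm_mul
@[simp] lemma counit_re : Coalgebra.counit (R := ℝ) re = 1 := lift_re (1 : ℝ) 0 (by simp)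
@[simp] lemma counit_im : Coalgebra.counit (R := ℝ) im = 0 := lift_im (1 : ℝ) 0 (by simp)

/-- The inverse `(a + b i)⁻¹ = (a - b i) / (a ^ 2 + b ^ 2)`. -/
instance : HopfAlgebra ℝ DeligneTorus :=
  .ofAlgHom
    (lift (re * inv) (-im * inv) (by
      refine .of_mul_eq_one (re ^ 2 + im ^ 2) ?_
      linear_combination (re ^ 2 + im ^ 2) * inv * norm_mul_inv + norm_mul_inv))
    (by
      apply algHom_ext <;> simp
      · linear_combination norm_mul_inv
      · ring)
    (by
      apply algHom_ext <;> simp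
      · linear_combination norm_mul_inv
      · ring)

/-- The real point of `S` given by `z ∈ ℂˣ = S(ℝ)`. -/
def point (z : ℂˣ) : DeligneTorus →ₐ[ℝ] ℝ :=
  lift (z : ℂ).re (z : ℂ).im (by
    have h : Complex.normSq (z : ℂ) ≠ 0 := by simp
    rw [Complex.normSq_apply] at h
    rw [isUnit_iff_ne_zero, pow_two, pow_two]
    exact h)

end DeligneTorus
section Adjoint

open WithConv Algebra.TensorProduct Coalgebra

variable {k : Type v} [Field k] {A : Type u} [CommRing A] [HopfAlgebra k A]

/-- A point `z ∈ G(R)` is central (lies in `Z(G)(R)`) if it commutes with all points of `G` over all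
`R`-algebras, equivalently with the universal point of `G` over `A ⊗ R`. -/
def IsCentral {R : Type w} [CommRing R] [Algebra k R] (z : A →ₐ[k] R) : Prop :=
  (toConv includeLeft * toConv (includeRight.comp z) : WithConv (A →ₐ[k] A ⊗[k] R)) =
    toConv (includeRight.comp z) * toConv includeLeft

lemma conv_left_right {R : Type w} [CommRing R] [Algebra k R] (z : A →ₐ[k] R) (a : A) :
    (toConv includeLeft * toConv (includeRight.comp z) : WithConv (A →ₐ[k] A ⊗[k] R)) a =
      z.toLinearMap.lTensor A (comul (R := k) a) := by
  rw [AlgHom.convMul_apply]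
  induction comul (R := k) a using TensorProduct.induction_on with
  | zero => simp
  | tmul x y => simp
  | add x y hx hy => rw [map_add, map_add, hx, hy]

lemma conv_right_left {R : Type w} [CommRing R] [Algebra k R] (z : A →ₐ[k] R) (a : A) :
    (toConv (includeRight.comp z) * toConv includeLeft : WithConv (A →ₐ[k] A ⊗[k] R)) a =
      z.toLinearMap.lTensor A (TensorProduct.comm k A A (comul (R := k) a)) := by
  rw [AlgHom.convMul_apply]
  induction comul (R := k) a using TensorProduct.induction_on with
  | zero => simp
  | tmul x y => simp
  | add x y hx hy => simp only [map_add, hx, hy]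

variable (k A) in
/-- The coordinate ring of `G^ad = G / Z(G)`: the functions `f` on `G` with `f (g z) = f g` for all
points `g` of `G` and `z` of the centre `Z(G)` (`g` is again the universal point). -/
def adjointSubalgebra : Subalgebra k A where
  carrier := {f | ∀ (R : Type u) [CommRing R] [Algebra k R] (z : A →ₐ[k] R), IsCentral z →
    (toConv includeLeft * toConv (includeRight.comp z) : WithConv (A →ₐ[k] A ⊗[k] R)) f = f ⊗ₜ 1}
  mul_mem' {a b} ha hb R _ _ z hz := by
    have h := map_mul (toConv includeLeft * toConv (includeRight.comp z) :
      WithConv (A →ₐ[k] A ⊗[k] R)).ofConv a b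
    refine h.trans ?_
    refine (congrArg₂ (· * ·) (ha R z hz) (hb R z hz)).trans ?_
    simp
  add_mem' {a b} ha hb R _ _ z hz := by
    have h := map_add (toConv includeLeft * toConv (includeRight.comp z) :
      WithConv (A →ₐ[k] A ⊗[k] R)).ofConv a b
    refine h.trans ?_
    refine (congrArg₂ (· + ·) (ha R z hz) (hb R z hz)).trans ?_
    rw [TensorProduct.add_tmul]
  algebraMap_mem' c R _ _ z hz := by
    refine (AlgHom.commutes (toConv includeLeft * toConv (includeRight.comp z) :
      WithConv (A →ₐ[k] A ⊗[k] R)).ofConv c).trans ?_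
    simp [Algebra.TensorProduct.algebraMap_apply]

lemma mem_adjointSubalgebra_iff {f : A} : f ∈ adjointSubalgebra k A ↔
    ∀ (R : Type u) [CommRing R] [Algebra k R] (z : A →ₐ[k] R), IsCentral z →
      z.toLinearMap.lTensor A (comul (R := k) f) = f ⊗ₜ 1 := by
  simp_rw [← conv_left_right]
  rfl

lemma IsCentral.comul_eq {R : Type w} [CommRing R] [Algebra k R] {z : A →ₐ[k] R}
    (hz : IsCentral z) (a : A) :
    z.toLinearMap.lTensor A (comul (R := k) a) =
      z.toLinearMap.lTensor A (TensorProduct.comm k A A (comul (R := k) a)) := by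
  rw [← conv_left_right, ← conv_right_left]
  exact congrArg (fun F : WithConv (A →ₐ[k] A ⊗[k] R) => F a) hz

lemma leftSlice_mem {f : A} (hf : f ∈ adjointSubalgebra k A) (l : A →ₗ[k] k) :
    TensorProduct.lid k A (l.rTensor A (comul (R := k) f)) ∈ adjointSubalgebra k A := by
  rw [mem_adjointSubalgebra_iff] at hf ⊢
  intro R _ _ z hz
  have h1 : ∀ t : A ⊗[k] A,
      z.toLinearMap.lTensor A (comul (R := k) (TensorProduct.lid k A (l.rTensor A t))) =
      TensorProduct.lid k (A ⊗[k] R) (l.rTensor (A ⊗[k] R)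
        ((z.toLinearMap.lTensor A).lTensor A ((comul (R := k)).lTensor A t))) := by
    intro t
    induction t using TensorProduct.induction_on with
    | zero => simp
    | tmul x y => simp
    | add x y hx hy => simp only [map_add, hx, hy]
  have h2 : ∀ t : A ⊗[k] A, (z.toLinearMap.lTensor A).lTensor A
      (TensorProduct.assoc k A A A ((comul (R := k)).rTensor A t)) =
      TensorProduct.assoc k A A R ((comul (R := k)).rTensor R (z.toLinearMap.lTensor A t)) := by
    intro t
    induction t using TensorProduct.induction_on with
    | zero => simp
    | tmul x y =>
      simp only [LinearMap.rTensor_tmul, LinearMap.lTensor_tmul]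
      induction comul (R := k) x using TensorProduct.induction_on with
      | zero => simp
      | tmul x y => simp
      | add x y hx hy => simp only [map_add, hx, hy, TensorProduct.add_tmul]
    | add x y hx hy => simp only [map_add, hx, hy]
  have h3 : ∀ t : A ⊗[k] A, TensorProduct.lid k (A ⊗[k] R) (l.rTensor (A ⊗[k] R)
      (TensorProduct.assoc k A A R (t ⊗ₜ 1))) =
      TensorProduct.lid k A (l.rTensor A t) ⊗ₜ 1 := by
    intro t
    induction t using TensorProduct.induction_on with
    | zero => simp
    | tmul x y => simp [TensorProduct.smul_tmul']
    | add x y hx hy => simp only [map_add, hx, hy, TensorProduct.add_tmul]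
  rw [h1, ← Coalgebra.coassoc_apply, h2, hf R z hz, LinearMap.rTensor_tmul, h3]

lemma rightSlice_mem {f : A} (hf : f ∈ adjointSubalgebra k A) (l : A →ₗ[k] k) :
    TensorProduct.rid k A (l.lTensor A (comul (R := k) f)) ∈ adjointSubalgebra k A := by
  rw [mem_adjointSubalgebra_iff] at hf ⊢
  intro R _ _ z hz
  have h1 : ∀ t : A ⊗[k] A,
      z.toLinearMap.lTensor A (comul (R := k) (TensorProduct.rid k A (l.lTensor A t))) =
      ((TensorProduct.rid k R).toLinearMap ∘ₗ TensorProduct.map z.toLinearMap l).lTensor A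
        (TensorProduct.assoc k A A A ((comul (R := k)).rTensor A t)) := by
    intro t
    induction t using TensorProduct.induction_on with
    | zero => simp
    | tmul x y =>
      simp only [LinearMap.rTensor_tmul, LinearMap.lTensor_tmul, TensorProduct.rid_tmul, map_smul]
      induction comul (R := k) x using TensorProduct.induction_on with
      | zero => simp
      | tmul x y => simp
      | add x y hx hy => simp only [map_add, hx, hy, TensorProduct.add_tmul, smul_add]
    | add x y hx hy => simp only [map_add, hx, hy]
  have h2 : ((TensorProduct.rid k R).toLinearMap ∘ₗ TensorProduct.map z.toLinearMap l) ∘ₗ comul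
      = ((TensorProduct.lid k R).toLinearMap ∘ₗ TensorProduct.map l z.toLinearMap) ∘ₗ comul := by
    ext a
    have e1 : ∀ t : A ⊗[k] A, TensorProduct.rid k R (TensorProduct.map z.toLinearMap l t) =
        TensorProduct.lid k R (l.rTensor R (z.toLinearMap.lTensor A
          (TensorProduct.comm k A A t))) := by
      intro t
      induction t using TensorProduct.induction_on with
      | zero => simp
      | tmul x y => simp
      | add x y hx hy => simp only [map_add, hx, hy]
    have e2 : ∀ t : A ⊗[k] A, TensorProduct.lid k R (TensorProduct.map l z.toLinearMap t) =
        TensorProduct.lid k R (l.rTensor R (z.toLinearMap.lTensor A t)) := by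
      intro t
      induction t using TensorProduct.induction_on with
      | zero => simp
      | tmul x y => simp
      | add x y hx hy => simp only [map_add, hx, hy]
    simp only [LinearMap.comp_apply, LinearEquiv.coe_coe]
    rw [e1, e2, hz.comul_eq]
  have h3 : ∀ t : A ⊗[k] A,
      ((TensorProduct.lid k R).toLinearMap ∘ₗ TensorProduct.map l z.toLinearMap).lTensor A
        (TensorProduct.assoc k A A A ((comul (R := k)).rTensor A t)) =
      ((TensorProduct.rid k A).toLinearMap ∘ₗ l.lTensor A).rTensor R
        ((comul (R := k)).rTensor R (z.toLinearMap.lTensor A t)) := by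
    intro t
    induction t using TensorProduct.induction_on with
    | zero => simp
    | tmul x y =>
      simp only [LinearMap.rTensor_tmul, LinearMap.lTensor_tmul]
      induction comul (R := k) x using TensorProduct.induction_on with
      | zero => simp
      | tmul x y => simp [TensorProduct.smul_tmul']
      | add x y hx hy => simp only [map_add, hx, hy, TensorProduct.add_tmul]
    | add x y hx hy => simp only [map_add, hx, hy]
  rw [h1, Coalgebra.coassoc_apply, ← LinearMap.comp_apply, ← LinearMap.lTensor_comp, h2,
    LinearMap.lTensor_comp, LinearMap.comp_apply, ← Coalgebra.coassoc_apply, h3, hf R z hz]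
  simp

lemma toConv_comp_antipode_mul {R : Type w} [CommRing R] [Algebra k R] (g : A →ₐ[k] R) :
    toConv (g.comp (HopfAlgebra.antipodeAlgHom k A)) * toConv g = 1 := by
  have h := AlgHom.comp_convMul_distrib g (toConv (HopfAlgebra.antipodeAlgHom k A))
    (toConv (AlgHom.id k A))
  rw [AlgHom.antipode_id_cancel] at h
  apply WithConv.ofConv_injective
  refine h.symm.trans ?_
  ext a
  simp [AlgHom.convOne_def]

lemma mul_toConv_comp_antipode {R : Type w} [CommRing R] [Algebra k R] (g : A →ₐ[k] R) :
    toConv g * toConv (g.comp (HopfAlgebra.antipodeAlgHom k A)) = 1 := by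
  have h0 : toConv (AlgHom.id k A) * toConv (HopfAlgebra.antipodeAlgHom k A) = 1 := by
    apply WithConv.ofConv_injective
    apply AlgHom.toLinearMap_injective
    apply WithConv.toConv_injective
    rw [AlgHom.toLinearMap_convMul, AlgHom.toLinearMap_convOne]
    simp [LinearMap.id_mul_antipode]
  have h := AlgHom.comp_convMul_distrib g (toConv (AlgHom.id k A))
    (toConv (HopfAlgebra.antipodeAlgHom k A))
  rw [h0] at h
  apply WithConv.ofConv_injective
  refine h.symm.trans ?_
  ext a
  simp [AlgHom.convOne_def]

lemma IsCentral.inv {R : Type w} [CommRing R] [Algebra k R] {z : A →ₐ[k] R}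
    (hz : IsCentral z) : IsCentral (z.comp (HopfAlgebra.antipodeAlgHom k A)) := by
  have hl := toConv_comp_antipode_mul (includeRight.comp z : A →ₐ[k] A ⊗[k] R)
  have hr := mul_toConv_comp_antipode (includeRight.comp z : A →ₐ[k] A ⊗[k] R)
  have hc : Commute (toConv includeLeft : WithConv (A →ₐ[k] A ⊗[k] R))
    (toConv (includeRight.comp z)) := hz
  let U : (WithConv (A →ₐ[k] A ⊗[k] R))ˣ := ⟨_, _, hr, hl⟩
  have hc' : Commute (toConv includeLeft : WithConv (A →ₐ[k] A ⊗[k] R)) (U : _) := hc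
  exact hc'.units_inv_right

lemma antipode_mem {f : A} (hf : f ∈ adjointSubalgebra k A) :
    HopfAlgebra.antipode k f ∈ adjointSubalgebra k A := by
  intro R _ _ z hz
  have hl := toConv_comp_antipode_mul (includeRight.comp z : A →ₐ[k] A ⊗[k] R)
  have hr := mul_toConv_comp_antipode (includeRight.comp z : A →ₐ[k] A ⊗[k] R)
  have hl' := toConv_comp_antipode_mul (includeLeft : A →ₐ[k] A ⊗[k] R)
  have hr' := mul_toConv_comp_antipode (includeLeft : A →ₐ[k] A ⊗[k] R)
  have H := mul_toConv_comp_antipode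
    (toConv includeLeft * toConv (includeRight.comp z) : WithConv (A →ₐ[k] A ⊗[k] R)).ofConv
  have hz' := hz.inv
  have key : toConv ((toConv includeLeft * toConv (includeRight.comp z) :
      WithConv (A →ₐ[k] A ⊗[k] R)).ofConv.comp (HopfAlgebra.antipodeAlgHom k A)) =
      toConv ((includeLeft : A →ₐ[k] A ⊗[k] R).comp (HopfAlgebra.antipodeAlgHom k A)) *
      toConv (includeRight.comp (z.comp (HopfAlgebra.antipodeAlgHom k A))) := by
    refine (left_inv_eq_right_inv ?_ H).symm
    have e : (toConv (includeRight.comp z) * toConv includeLeft : WithConv (A →ₐ[k] A ⊗[k] R)) =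
      toConv includeLeft * toConv (includeRight.comp z) := hz.symm
    change _ * (toConv includeLeft * toConv (includeRight.comp z)) = 1
    rw [← e, mul_assoc, ← mul_assoc (toConv (includeRight.comp (z.comp _)))]
    rw [← AlgHom.comp_assoc, hl, one_mul, hl']
  have e1 := congrArg (fun F : WithConv (A →ₐ[k] A ⊗[k] R) => F f) key
  refine e1.trans ?_
  have e2 := hf R _ hz'
  rw [conv_left_right] at e2
  have e3 := congrArg ((HopfAlgebra.antipode k (A := A)).rTensor R) e2
  rw [LinearMap.rTensor_tmul] at e3
  rw [← e3]
  rw [AlgHom.convMul_apply]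
  induction comul (R := k) f using TensorProduct.induction_on with
  | zero => simp
  | tmul x y => simp
  | add x y hx hy => simp only [map_add, hx, hy]


variable (k A) in
/-- The Hopf algebra `O(G^ad)` of the adjoint group `G^ad = G / Z(G)`. -/
abbrev AdjointRing : Type u := adjointSubalgebra k A

lemma tensor_val_injective : Function.Injective
    (Algebra.TensorProduct.map (adjointSubalgebra k A).val (adjointSubalgebra k A).val) :=
  TensorProduct.map_injective_of_flat_flat (adjointSubalgebra k A).val.toLinearMap
    (adjointSubalgebra k A).val.toLinearMap Subtype.val_injective Subtype.val_injective

lemma eq_of_leftSlice {V W : Type*} [AddCommGroup V] [Module k V] [AddCommGroup W] [Module k W]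
    {s t : V ⊗[k] W}
    (h : ∀ l : V →ₗ[k] k, TensorProduct.lid k W (l.rTensor W s) =
      TensorProduct.lid k W (l.rTensor W t)) : s = t := by
  classical
  let b := Module.Basis.ofVectorSpace k V
  apply (TensorProduct.equivFinsuppOfBasisLeft b).injective
  ext i
  have key : ∀ r : V ⊗[k] W, TensorProduct.equivFinsuppOfBasisLeft b r i =
      TensorProduct.lid k W ((b.coord i).rTensor W r) := by
    intro r
    induction r using TensorProduct.induction_on with
    | zero => simp
    | tmul x y => simp
    | add x y hx hy => simp only [map_add, Finsupp.add_apply, hx, hy]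
  rw [key, key, h]

lemma comul_mem_range (f : adjointSubalgebra k A) :
    comul (R := k) (f : A) ∈ (Algebra.TensorProduct.map (adjointSubalgebra k A).val
      (adjointSubalgebra k A).val).range := by
  obtain ⟨p, hp⟩ := LinearMap.exists_leftInverse_of_injective
    (adjointSubalgebra k A).val.toLinearMap (LinearMap.ker_eq_bot.2 Subtype.val_injective)
  have hp' : ∀ a ∈ adjointSubalgebra k A, ((p a : adjointSubalgebra k A) : A) = a := fun a ha =>
    congrArg Subtype.val (LinearMap.congr_fun hp ⟨a, ha⟩)
  let e : A →ₗ[k] A := (adjointSubalgebra k A).val.toLinearMap ∘ₗ p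
  have h1 : e.lTensor A (comul (R := k) (f : A)) = comul (R := k) (f : A) := by
    refine eq_of_leftSlice fun l => ?_
    have := hp' _ (leftSlice_mem f.2 l)
    refine Eq.trans ?_ this
    change _ = e _
    generalize comul (R := k) (f : A) = t
    induction t using TensorProduct.induction_on with
    | zero => simp
    | tmul x y => simp
    | add x y hx hy => simp only [map_add, hx, hy]
  have h2 : e.rTensor A (comul (R := k) (f : A)) = comul (R := k) (f : A) := by
    apply (TensorProduct.comm k A A).injective
    refine eq_of_leftSlice fun l => ?_
    have := hp' _ (rightSlice_mem f.2 l)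
    have e1 : ∀ t : A ⊗[k] A, TensorProduct.lid k A (l.rTensor A (TensorProduct.comm k A A t)) =
        TensorProduct.rid k A (l.lTensor A t) := by
      intro t
      induction t using TensorProduct.induction_on with
      | zero => simp
      | tmul x y => simp
      | add x y hx hy => simp only [map_add, hx, hy]
    rw [e1, e1]
    refine Eq.trans ?_ this
    change _ = e _
    generalize comul (R := k) (f : A) = t
    induction t using TensorProduct.induction_on with
    | zero => simp
    | tmul x y => simp
    | add x y hx hy => simp only [map_add, hx, hy]
  refine ⟨TensorProduct.map p p (comul (R := k) (f : A)), ?_⟩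
  rw [← h1, ← h2]
  generalize comul (R := k) (f : A) = t
  change Algebra.TensorProduct.map _ _ _ = _
  have hpe : ∀ a, p (e a) = p a := fun a => LinearMap.congr_fun hp (p a)
  induction t using TensorProduct.induction_on with
  | zero => simp
  | tmul x y => simp [hpe]; simp [e]
  | add x y hx hy => simp only [map_add, hx, hy]

variable (k A) in
/-- The comultiplication of `O(G)`, restricted to `O(G^ad)`. -/
def adjointComul : AdjointRing k A →ₐ[k] AdjointRing k A ⊗[k] AdjointRing k A :=
  (AlgEquiv.ofInjective _ (tensor_val_injective (k := k) (A := A))).symm.toAlgHom.comp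
    (((Bialgebra.comulAlgHom k A).comp (adjointSubalgebra k A).val).codRestrict _ comul_mem_range)

lemma map_val_adjointComul (f : AdjointRing k A) :
    Algebra.TensorProduct.map (adjointSubalgebra k A).val (adjointSubalgebra k A).val
      (adjointComul k A f) = comul (R := k) (f : A) :=
  congrArg Subtype.val ((AlgEquiv.ofInjective _ (tensor_val_injective (k := k) (A := A))).apply_symm_apply
    ⟨comul (R := k) (f : A), comul_mem_range f⟩)

instance : Bialgebra k (AdjointRing k A) :=
  .ofAlgHom (adjointComul k A) ((Bialgebra.counitAlgHom k A).comp (adjointSubalgebra k A).val)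
    (by
      have inj : Function.Injective (Algebra.TensorProduct.map (adjointSubalgebra k A).val
          (Algebra.TensorProduct.map (adjointSubalgebra k A).val (adjointSubalgebra k A).val)) :=
        TensorProduct.map_injective_of_flat_flat (adjointSubalgebra k A).val.toLinearMap
          (Algebra.TensorProduct.map (adjointSubalgebra k A).val
            (adjointSubalgebra k A).val).toLinearMap Subtype.val_injective tensor_val_injective
      ext f : 1
      apply inj
      have e1 : ∀ t : AdjointRing k A ⊗[k] AdjointRing k A,
          Algebra.TensorProduct.map (adjointSubalgebra k A).val
            (Algebra.TensorProduct.map (adjointSubalgebra k A).val (adjointSubalgebra k A).val)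
            (Algebra.TensorProduct.assoc k k k _ _ _
              (Algebra.TensorProduct.map (adjointComul k A) (AlgHom.id k _) t)) =
          TensorProduct.assoc k A A A ((comul (R := k)).rTensor A
            (Algebra.TensorProduct.map (adjointSubalgebra k A).val
              (adjointSubalgebra k A).val t)) := by
        intro t
        induction t using TensorProduct.induction_on with
        | zero => simp
        | tmul x y =>
          simp only [Algebra.TensorProduct.map_tmul, LinearMap.rTensor_tmul,
            Subalgebra.coe_val, ← map_val_adjointComul]
          induction adjointComul k A x using TensorProduct.induction_on with
          | zero => simp
          | tmul x y => simp
          | add x y hx hy => simp only [map_add, hx, hy, TensorProduct.add_tmul]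
        | add x y hx hy => simp only [map_add, hx, hy]
      have e2 : ∀ t : AdjointRing k A ⊗[k] AdjointRing k A,
          Algebra.TensorProduct.map (adjointSubalgebra k A).val
            (Algebra.TensorProduct.map (adjointSubalgebra k A).val (adjointSubalgebra k A).val)
            (Algebra.TensorProduct.map (AlgHom.id k _) (adjointComul k A) t) =
          (comul (R := k)).lTensor A
            (Algebra.TensorProduct.map (adjointSubalgebra k A).val
              (adjointSubalgebra k A).val t) := by
        intro t
        induction t using TensorProduct.induction_on with
        | zero => simp
        | tmul x y => simp [map_val_adjointComul]
        | add x y hx hy => simp only [map_add, hx, hy]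
      refine (e1 (adjointComul k A f)).trans (Eq.trans ?_ (e2 (adjointComul k A f)).symm)
      rw [map_val_adjointComul, Coalgebra.coassoc_apply])
    (by
      ext f : 1
      apply (TensorProduct.lid k _).injective
      apply Subtype.val_injective
      have e : ∀ t : AdjointRing k A ⊗[k] AdjointRing k A,
          ((TensorProduct.lid k _ (Algebra.TensorProduct.map
            ((Bialgebra.counitAlgHom k A).comp (adjointSubalgebra k A).val)
            (AlgHom.id k _) t) : AdjointRing k A) : A) =
          TensorProduct.lid k A ((counit (R := k)).rTensor A
            (Algebra.TensorProduct.map (adjointSubalgebra k A).val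
              (adjointSubalgebra k A).val t)) := by
        intro t
        induction t using TensorProduct.induction_on with
        | zero => simp
        | tmul x y => simp
        | add x y hx hy => simp only [map_add, hx, hy, Subalgebra.coe_add]
      refine (e (adjointComul k A f)).trans ?_
      rw [map_val_adjointComul]
      simp)
    (by
      ext f : 1
      apply (TensorProduct.rid k _).injective
      apply Subtype.val_injective
      have e : ∀ t : AdjointRing k A ⊗[k] AdjointRing k A,
          ((TensorProduct.rid k _ (Algebra.TensorProduct.map (AlgHom.id k _)
            ((Bialgebra.counitAlgHom k A).comp (adjointSubalgebra k A).val)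
            t) : AdjointRing k A) : A) =
          TensorProduct.rid k A ((counit (R := k)).lTensor A
            (Algebra.TensorProduct.map (adjointSubalgebra k A).val
              (adjointSubalgebra k A).val t)) := by
        intro t
        induction t using TensorProduct.induction_on with
        | zero => simp
        | tmul x y => simp
        | add x y hx hy => simp only [map_add, hx, hy, Subalgebra.coe_add]
      refine (e (adjointComul k A f)).trans ?_
      rw [map_val_adjointComul]
      simp)

lemma map_val_comul (f : AdjointRing k A) :
    Algebra.TensorProduct.map (adjointSubalgebra k A).val (adjointSubalgebra k A).val
      (comul (R := k) f) = comul (R := k) (f : A) :=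
  map_val_adjointComul f

lemma counit_adjoint (f : AdjointRing k A) :
    counit (R := k) f = counit (R := k) (f : A) := rfl

variable (k A) in
/-- The antipode of `O(G)`, restricted to `O(G^ad)`. -/
def adjointAntipode : AdjointRing k A →ₐ[k] AdjointRing k A :=
  ((HopfAlgebra.antipodeAlgHom k A).comp (adjointSubalgebra k A).val).codRestrict _
    fun f => antipode_mem f.2

lemma coe_adjointAntipode (f : AdjointRing k A) :
    (adjointAntipode k A f : A) = HopfAlgebra.antipode k (f : A) := rfl

instance : HopfAlgebra k (AdjointRing k A) :=
  .ofAlgHom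
    (adjointAntipode k A)
    (by
      ext f
      have e : ∀ t : AdjointRing k A ⊗[k] AdjointRing k A,
          ((Algebra.TensorProduct.lift (adjointAntipode k A)
            (AlgHom.id k _) (fun _ _ => Commute.all _ _) t : AdjointRing k A) : A) =
          LinearMap.mul' k A ((HopfAlgebra.antipode k).rTensor A
            (Algebra.TensorProduct.map (adjointSubalgebra k A).val
              (adjointSubalgebra k A).val t)) := by
        intro t
        induction t using TensorProduct.induction_on with
        | zero => simp
        | tmul x y => simp [coe_adjointAntipode]
        | add x y hx hy => simp only [map_add, hx, hy, Subalgebra.coe_add]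
      refine (e _).trans ?_
      refine (congrArg (fun t => LinearMap.mul' k A ((HopfAlgebra.antipode k).rTensor A t))
        (map_val_comul f)).trans ?_
      rw [HopfAlgebra.mul_antipode_rTensor_comul_apply]
      rfl)
    (by
      ext f
      have e : ∀ t : AdjointRing k A ⊗[k] AdjointRing k A,
          ((Algebra.TensorProduct.lift (AlgHom.id k _) (adjointAntipode k A)
            (fun _ _ => Commute.all _ _) t : AdjointRing k A) : A) =
          LinearMap.mul' k A ((HopfAlgebra.antipode k).lTensor A
            (Algebra.TensorProduct.map (adjointSubalgebra k A).val
              (adjointSubalgebra k A).val t)) := by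
        intro t
        induction t using TensorProduct.induction_on with
        | zero => simp
        | tmul x y => simp [coe_adjointAntipode]
        | add x y hx hy => simp only [map_add, hx, hy, Subalgebra.coe_add]
      refine (e _).trans ?_
      refine (congrArg (fun t => LinearMap.mul' k A ((HopfAlgebra.antipode k).lTensor A t))
        (map_val_comul f)).trans ?_
      rw [HopfAlgebra.mul_antipode_lTensor_comul_apply]
      rfl)

variable (k A) in
/-- The quotient homomorphism `G → G^ad`, i.e. the inclusion `O(G^ad) ⊆ O(G)`. -/
def toAdjoint : AdjointRing k A →ₐc[k] A :=
  .ofAlgHom (adjointSubalgebra k A).val rfl (by ext f : 1; exact map_val_comul f)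

end Adjoint

section Normal

open WithConv Algebra.TensorProduct Coalgebra

variable (k : Type v) [Field k] {A : Type u} [CommRing A] [HopfAlgebra k A]

variable (A) in
/-- The morphism `G × G → G`, `(x, g) ↦ g x g⁻¹`. -/
def conjugation : A →ₐ[k] A ⊗[k] A :=
  (toConv includeRight * toConv includeLeft *
    toConv (includeRight.comp (HopfAlgebra.antipodeAlgHom k A)) :
      WithConv (A →ₐ[k] A ⊗[k] A)).ofConv

/-- The closed subgroup `N = V(I)` is normal: `g x g⁻¹ ∈ N` for `x ∈ N`, `g ∈ G`. -/
def IsNormal (I : Ideal A) : Prop :=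
  ∀ f ∈ I, Algebra.TensorProduct.map (Ideal.Quotient.mkₐ k I) (AlgHom.id k A)
    (conjugation k A f) = 0

variable (A) in
/-- `G` is unipotent: every nonzero subrepresentation `V` of the regular representation `O(G)`
has a nonzero fixed vector, i.e. contains the constants. (Every simple representation embeds in
the regular one, so this says that all simple representations are trivial.) -/
def IsUnipotent : Prop :=
  ∀ V : Submodule k A, V ≠ ⊥ →
    (∀ v ∈ V, comul (R := k) v ∈ LinearMap.range (V.subtype.rTensor A)) → (1 : A) ∈ V

variable (A) in
/-- `G` is a connected reductive algebraic group over `k`: of finite type, smooth and connected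
(stated as geometrically integral), and `G` over an algebraic closure has no nontrivial smooth
connected normal unipotent subgroup. -/
structure IsConnectedReductive : Prop where
  finiteType : Algebra.FiniteType k A
  connected : IsDomain (AlgebraicClosure k ⊗[k] A)
  reductive : ∀ (I : Ideal (AlgebraicClosure k ⊗[k] A)) [I.IsHopfIdeal (AlgebraicClosure k)],
    IsNormal (AlgebraicClosure k) I →
    IsDomain ((AlgebraicClosure k ⊗[k] A) ⧸ I) →
    IsUnipotent (AlgebraicClosure k) ((AlgebraicClosure k ⊗[k] A) ⧸ I) →
    I = RingHom.ker (Bialgebra.counitAlgHom (AlgebraicClosure k) (AlgebraicClosure k ⊗[k] A))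

end Normal

section DeligneHom

open WithConv Algebra.TensorProduct Coalgebra

/-- Homomorphisms `h : S → G_ℝ` of algebraic groups over `ℝ`, for `G` over `ℚ`. -/
abbrev DeligneHom (A : Type u) [CommRing A] [HopfAlgebra ℚ A] : Type u :=
  ℝ ⊗[ℚ] A →ₐc[ℝ] DeligneTorus

namespace DeligneHom

variable {A : Type u} [CommRing A] [HopfAlgebra ℚ A] {B : Type v} [CommRing B] [HopfAlgebra ℚ B]

/-- The composite `φ ∘ h : S → H_ℝ` for a homomorphism `φ : G → H` over `ℚ`. -/
def map (φ : B →ₐc[ℚ] A) (h : DeligneHom A) : DeligneHom B :=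
  h.comp (Bialgebra.TensorProduct.map (BialgHom.id ℝ ℝ) φ)

/-- `h` as a point of `G` with values in `O(S)`. -/
def restrict (h : DeligneHom A) : A →ₐ[ℚ] DeligneTorus :=
  ((h : ℝ ⊗[ℚ] A →ₐ[ℝ] DeligneTorus).restrictScalars ℚ).comp includeRight

@[simp] lemma restrict_apply (h : DeligneHom A) (a : A) : h.restrict a = h (1 ⊗ₜ a) := rfl

lemma restrict_injective : Function.Injective (restrict (A := A)) := by
  intro h h' e
  have : (h : ℝ ⊗[ℚ] A →ₐ[ℝ] DeligneTorus) = h' :=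
    Algebra.TensorProduct.ext (by ext) e
  ext x
  exact AlgHom.congr_fun this x

lemma counit_restrict (h : DeligneHom A) (a : A) :
    counit (R := ℝ) (h.restrict a) = (counit (R := ℚ) a : ℝ) := by
  rw [restrict_apply, CoalgHomClass.counit_comp_apply]
  simp [Algebra.smul_def]

/-- Auxiliary map `a ⊗ b ↦ f a ⊗ f b`. -/
def double (f : A →ₐ[ℚ] DeligneTorus) : A ⊗[ℚ] A →ₐ[ℚ] DeligneTorus ⊗[ℝ] DeligneTorus :=
  Algebra.TensorProduct.lift
    (((includeLeft : DeligneTorus →ₐ[ℝ] DeligneTorus ⊗[ℝ] DeligneTorus).restrictScalars ℚ).comp f)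
    (((includeRight : DeligneTorus →ₐ[ℝ] DeligneTorus ⊗[ℝ] DeligneTorus).restrictScalars ℚ).comp f)
    (fun _ _ => Commute.all _ _)

lemma double_tmul (f : A →ₐ[ℚ] DeligneTorus) (a b : A) :
    double f (a ⊗ₜ b) = f a ⊗ₜ[ℝ] f b := by
  simp [double]

lemma comul_one_tmul (a : A) : comul (R := ℝ) ((1 : ℝ) ⊗ₜ[ℚ] a) =
    Algebra.TensorProduct.lift
    (((includeLeft : ℝ ⊗[ℚ] A →ₐ[ℝ] (ℝ ⊗[ℚ] A) ⊗[ℝ] (ℝ ⊗[ℚ] A)).restrictScalars ℚ).comp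
      includeRight)
    (((includeRight : ℝ ⊗[ℚ] A →ₐ[ℝ] (ℝ ⊗[ℚ] A) ⊗[ℝ] (ℝ ⊗[ℚ] A)).restrictScalars ℚ).comp
      includeRight)
    (fun _ _ => Commute.all _ _) (comul (R := ℚ) a) := by
  rw [← (ℛ ℚ a).eq]
  simp only [map_sum, Algebra.TensorProduct.lift_tmul]
  rw [TensorProduct.comul_tmul, ← (ℛ ℚ a).eq]
  simp [TensorProduct.tmul_sum]

lemma comul_restrict (h : DeligneHom A) (a : A) :
    comul (R := ℝ) (h.restrict a) = double h.restrict (comul (R := ℚ) a) := by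
  rw [restrict_apply, ← CoalgHomClass.map_comp_comul_apply, comul_one_tmul]
  induction comul (R := ℚ) a using TensorProduct.induction_on with
  | zero => simp
  | tmul x y => simp [double_tmul]
  | add x y hx hy => simp only [map_add, hx, hy]

/-- A homomorphism `S → G_ℝ` from a multiplicative `O(S)`-valued point of `G`. -/
def ofAlgHom (f : A →ₐ[ℚ] DeligneTorus)
    (h₁ : ∀ a, counit (R := ℝ) (f a) = (counit (R := ℚ) a : ℝ))
    (h₂ : ∀ a, comul (R := ℝ) (f a) = double f (comul (R := ℚ) a)) : DeligneHom A :=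
  BialgHom.ofAlgHom (Algebra.TensorProduct.lift (Algebra.ofId ℝ DeligneTorus) f
      (fun _ _ => Commute.all _ _))
    (by
      refine Algebra.TensorProduct.ext (by ext) ?_
      ext a
      simp [h₁])
    (by
      refine Algebra.TensorProduct.ext (by ext) ?_
      ext a
      simp only [AlgHom.coe_comp, AlgHom.coe_restrictScalars', Function.comp_apply,
        includeRight_apply, Bialgebra.comulAlgHom_apply, lift_tmul, map_one, one_mul, h₂]
      rw [comul_one_tmul]
      induction comul (R := ℚ) a using TensorProduct.induction_on with
      | zero => simp
      | tmul x y => simp [double_tmul]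
      | add x y hx hy => simp only [map_add, hx, hy])

@[simp] lemma restrict_ofAlgHom (f : A →ₐ[ℚ] DeligneTorus)
    (h₁ : ∀ a, counit (R := ℝ) (f a) = (counit (R := ℚ) a : ℝ))
    (h₂ : ∀ a, comul (R := ℝ) (f a) = double f (comul (R := ℚ) a)) :
    (ofAlgHom f h₁ h₂).restrict = f := by
  ext a
  have : Algebra.TensorProduct.lift (Algebra.ofId ℝ DeligneTorus) f (fun _ _ => Commute.all _ _)
      ((1 : ℝ) ⊗ₜ[ℚ] a) = f a := by simp
  exact this

/-- The point `h(z) ∈ G(ℝ)` for `z ∈ ℂˣ = S(ℝ)`. -/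
def point (h : DeligneHom A) (z : ℂˣ) : A →ₐ[ℚ] ℝ :=
  ((DeligneTorus.point z).restrictScalars ℚ).comp h.restrict

/-- `h' = g h g⁻¹` for `g ∈ G(ℝ)`. -/
def IsConjugate (g : A →ₐ[ℚ] ℝ) (h h' : DeligneHom A) : Prop :=
  toConv h'.restrict =
    toConv (((Algebra.ofId ℝ DeligneTorus).restrictScalars ℚ).comp g) * toConv h.restrict *
    toConv ((((Algebra.ofId ℝ DeligneTorus).restrictScalars ℚ).comp g).comp
      (HopfAlgebra.antipodeAlgHom ℚ A))

/-- The composite `h^ad : S → G_ℝ → G^ad_ℝ`. -/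
def ad (h : DeligneHom A) : DeligneHom (AdjointRing ℚ A) := h.map (toAdjoint ℚ A)

/-- The ideal of the Mumford-Tate group of `h`: the smallest closed subgroup `H` of `G` over `ℚ` such
that `h` factors through `H_ℝ` (the largest Hopf ideal of `O(G)` on which `h` vanishes). -/
def mtIdeal (h : DeligneHom A) : Ideal A :=
  sSup {I : Ideal A | I.IsHopfIdeal ℚ ∧ ∀ a ∈ I, h (1 ⊗ₜ a) = 0}

lemma mtIdeal_le_ker (h : DeligneHom A) {a : A} (ha : a ∈ h.mtIdeal) : h (1 ⊗ₜ a) = 0 := by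
  have : h.mtIdeal ≤ RingHom.ker h.restrict :=
    sSup_le fun I hI a ha => hI.2 a ha
  exact this ha

instance (h : DeligneHom A) : h.mtIdeal.IsHopfIdeal ℚ where
  counit_eq_zero := by
    have : h.mtIdeal ≤ RingHom.ker (Bialgebra.counitAlgHom ℚ A) :=
      sSup_le fun I hI a ha =>
        have := hI.1
        Submodule.IsCoideal.counit_eq_zero (R := ℚ) (I := I.restrictScalars ℚ) ha
    exact fun a ha => this ha
  map_mkQ_comul_eq_zero := by
    have : h.mtIdeal ≤ RingHom.ker ((Algebra.TensorProduct.map (Ideal.Quotient.mkₐ ℚ h.mtIdeal)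
        (Ideal.Quotient.mkₐ ℚ h.mtIdeal)).comp (Bialgebra.comulAlgHom ℚ A)) := by
      refine sSup_le fun I hI a ha => ?_
      have := hI.1
      have hle : I ≤ h.mtIdeal := le_sSup hI
      have e : Algebra.TensorProduct.map (Ideal.Quotient.mkₐ ℚ I) (Ideal.Quotient.mkₐ ℚ I)
          (comul (R := ℚ) a) = 0 :=
        Submodule.IsCoideal.map_mkQ_comul_eq_zero (R := ℚ) (I := I.restrictScalars ℚ) ha
      have e2 := congrArg (Algebra.TensorProduct.map (Ideal.Quotient.factorₐ ℚ hle)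
        (Ideal.Quotient.factorₐ ℚ hle)) e
      rw [map_zero] at e2
      rw [RingHom.mem_ker, ← e2, AlgHom.comp_apply, Bialgebra.comulAlgHom_apply,
        ← AlgHom.comp_apply, ← Algebra.TensorProduct.map_comp]
      rfl
    exact fun a ha => this ha
  antipode_mem := by
    have : h.mtIdeal ≤ h.mtIdeal.comap (HopfAlgebra.antipodeAlgHom ℚ A) :=
      sSup_le fun I hI a ha =>
        have hle : I ≤ h.mtIdeal := le_sSup hI
        hle (hI.1.antipode_mem ha)
    exact fun a ha => this ha

/-- The coordinate ring of the Mumford-Tate group `M_h`. -/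
abbrev MumfordTate (h : DeligneHom A) : Type u := A ⧸ h.mtIdeal

/-- `h` as a homomorphism `S → (M_h)_ℝ`. -/
def toMumfordTate (h : DeligneHom A) : DeligneHom h.MumfordTate :=
  ofAlgHom (Ideal.Quotient.liftₐ h.mtIdeal h.restrict fun _ ha => h.mtIdeal_le_ker ha)
    (by
      intro a
      obtain ⟨a, rfl⟩ := Ideal.Quotient.mk_surjective a
      exact h.counit_restrict a)
    (by
      intro a
      obtain ⟨a, rfl⟩ := Ideal.Quotient.mk_surjective a
      refine (h.comul_restrict a).trans ?_
      rw [Bialgebra.Quotient.comul_mk]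
      induction comul (R := ℚ) a using TensorProduct.induction_on with
      | zero => simp
      | tmul x y => rw [double_tmul, TensorProduct.map_tmul, double_tmul]; rfl
      | add x y hx hy => simp only [map_add, hx, hy])

lemma map_toMumfordTate (h : DeligneHom A) :
    h.toMumfordTate.map (Bialgebra.Quotient.mkBialgHom h.mtIdeal) = h := by
  apply restrict_injective
  ext a
  have e : h.toMumfordTate.restrict (Ideal.Quotient.mk _ a) = h.restrict a := by
    rw [toMumfordTate, restrict_ofAlgHom]; rfl
  exact e

section Prod

variable {A₁ : Type u} [CommRing A₁] [HopfAlgebra ℚ A₁]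
  {A₂ : Type v} [CommRing A₂] [HopfAlgebra ℚ A₂]

variable (A₁ A₂) in
/-- The projection `G₁ × G₂ → G₁`. -/
def fst : A₁ →ₐc[ℚ] A₁ ⊗[ℚ] A₂ :=
  BialgHom.ofAlgHom (R := ℚ) (A := A₁) (B := A₁ ⊗[ℚ] A₂) includeLeft
     (AlgHom.ext fun a => by simp) (AlgHom.ext fun a => by
    simp only [AlgHom.coe_comp, Function.comp_apply, Bialgebra.comulAlgHom_apply,
      includeLeft_apply, TensorProduct.comul_tmul, Bialgebra.comul_one,
      Algebra.TensorProduct.one_def]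
    induction comul (R := ℚ) a using TensorProduct.induction_on with
    | zero => simp
    | tmul x y => simp
    | add x y hx hy => simp only [map_add, hx, hy, TensorProduct.add_tmul])

variable (A₁ A₂) in
/-- The projection `G₁ × G₂ → G₂`. -/
def snd : A₂ →ₐc[ℚ] A₁ ⊗[ℚ] A₂ :=
  BialgHom.ofAlgHom (R := ℚ) (A := A₂) (B := A₁ ⊗[ℚ] A₂) includeRight
     (AlgHom.ext fun a => by simp) (AlgHom.ext fun a => by
    simp only [AlgHom.coe_comp, Function.comp_apply, Bialgebra.comulAlgHom_apply,
      includeRight_apply, TensorProduct.comul_tmul, Bialgebra.comul_one,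
      Algebra.TensorProduct.one_def]
    induction comul (R := ℚ) a using TensorProduct.induction_on with
    | zero => simp
    | tmul x y => simp
    | add x y hx hy => simp only [map_add, hx, hy, TensorProduct.tmul_add])

/-- The homomorphism `(h₁, h₂) : S → (G₁ × G₂)_ℝ`. -/
def pair (h₁ : DeligneHom A₁) (h₂ : DeligneHom A₂) : DeligneHom (A₁ ⊗[ℚ] A₂) :=
  ofAlgHom (Algebra.TensorProduct.lift h₁.restrict h₂.restrict fun _ _ => Commute.all _ _)
    (by
      intro a
      induction a using TensorProduct.induction_on with
      | zero => simp
      | tmul x y =>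
        rw [lift_tmul, Bialgebra.counit_mul, counit_restrict, counit_restrict]
        simp [mul_comm]
      | add x y hx hy => simp only [map_add, hx, hy, Rat.cast_add])
    (by
      intro a
      induction a using TensorProduct.induction_on with
      | zero => simp
      | tmul x y =>
        rw [lift_tmul, Bialgebra.comul_mul, comul_restrict, comul_restrict,
          TensorProduct.comul_tmul, ← (ℛ ℚ x).eq, ← (ℛ ℚ y).eq]
        simp [TensorProduct.sum_tmul, TensorProduct.tmul_sum, double_tmul, Finset.sum_mul_sum]
        rw [Finset.sum_comm]
      | add x y hx hy => simp only [map_add, hx, hy])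

lemma restrict_pair (h₁ : DeligneHom A₁) (h₂ : DeligneHom A₂) : (pair h₁ h₂).restrict =
    Algebra.TensorProduct.lift h₁.restrict h₂.restrict fun _ _ => Commute.all _ _ :=
  restrict_ofAlgHom _ _ _

/-- The identification of homomorphisms `S → (G₁ × G₂)_ℝ` with pairs
of homomorphisms, by `h ↦ (pr₁ ∘ h, pr₂ ∘ h)`. -/
def prodEquiv : DeligneHom (A₁ ⊗[ℚ] A₂) ≃ DeligneHom A₁ × DeligneHom A₂ where
  toFun h := (h.map (fst A₁ A₂), h.map (snd A₁ A₂))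
  invFun p := pair p.1 p.2
  left_inv h := by
    apply restrict_injective
    rw [restrict_pair]
    apply Algebra.TensorProduct.ext
    · ext a
      simp only [AlgHom.coe_comp, Function.comp_apply, includeLeft_apply, lift_tmul, map_one,
        mul_one]
      rfl
    · ext a
      simp only [AlgHom.coe_comp, Function.comp_apply, includeRight_apply, lift_tmul, map_one,
        one_mul, AlgHom.coe_restrictScalars']
      rfl
  right_inv p := by
    ext1
    · apply restrict_injective
      ext a
      have e : (pair p.1 p.2).restrict (a ⊗ₜ 1) = p.1.restrict a := by
        rw [restrict_pair, lift_tmul, map_one, mul_one]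
      exact e
    · apply restrict_injective
      ext a
      have e : (pair p.1 p.2).restrict (1 ⊗ₜ a) = p.2.restrict a := by
        rw [restrict_pair, lift_tmul, map_one, one_mul]
      exact e

end Prod
end DeligneHom
end DeligneHom

section ShimuraDatum

open WithConv

variable {A : Type u} [CommRing A] [HopfAlgebra ℚ A]

variable (A) in
/-- `Lie(G)_ℂ`: the `ℂ`-valued derivations of `O(G)` at the identity. -/
def lieAlgebra : Submodule ℂ (A →ₗ[ℚ] ℂ) where
  carrier := {D | ∀ a b, D (a * b) =
    (Coalgebra.counit (R := ℚ) a : ℂ) * D b + (Coalgebra.counit (R := ℚ) b : ℂ) * D a}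
  add_mem' {D E} hD hE a b := by
    simp only [LinearMap.add_apply, hD a b, hE a b]; ring
  zero_mem' a b := by simp
  smul_mem' c D hD a b := by
    simp only [LinearMap.smul_apply, hD a b, smul_eq_mul]; ring

/-- The adjoint action of `g ∈ G(ℂ)`: `f ↦ D (x ↦ f (g x g⁻¹))`. -/
def Ad (g : A →ₐ[ℚ] ℂ) (D : A →ₗ[ℚ] ℂ) : A →ₗ[ℚ] ℂ :=
  (toConv g.toLinearMap * toConv D *
    toConv (g.comp (HopfAlgebra.antipodeAlgHom ℚ A)).toLinearMap).ofConv

/-- The inclusion `G(ℝ) ⊆ G(ℂ)`. -/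
def complexPoint (g : A →ₐ[ℚ] ℝ) : A →ₐ[ℚ] ℂ := (Complex.ofRealAm.restrictScalars ℚ).comp g

/-- Complex conjugation on `G(ℂ)`. -/
def conjPoint (g : A →ₐ[ℚ] ℂ) : A →ₐ[ℚ] ℂ :=
  ((Complex.conjAe : ℂ →ₐ[ℝ] ℂ).restrictScalars ℚ).comp g

/-- `D ∈ Lie(G)_ℂ` is of Hodge type `(-p, p)` for `Ad ∘ h`: `z ∈ ℂˣ` acts on it by `(z / z̄) ^ p`. -/
def HasHodgeType (h : DeligneHom A) (p : ℤ) (D : A →ₗ[ℚ] ℂ) : Prop :=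
  D ∈ lieAlgebra A ∧ ∀ z : ℂˣ,
    Ad (complexPoint (h.point z)) D = ((z : ℂ) / (starRingEnd ℂ) (z : ℂ)) ^ p • D

/-- `{g ∈ G(ℂ) | g = s ḡ s⁻¹}`, as a set of functions `O(G) → ℂ`. It carries the topology of pointwise
convergence, which is the usual topology of `G(ℂ)`. The involution `ad s` of `G_ℝ` is a Cartan
involution if this set is compact. -/
def compactForm (s : A →ₐ[ℚ] ℝ) : Set (A → ℂ) :=
  {F | ∃ g : A →ₐ[ℚ] ℂ, F = g ∧ toConv g = toConv (complexPoint s) * toConv (conjPoint g) *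
    toConv ((complexPoint s).comp (HopfAlgebra.antipodeAlgHom ℚ A))}

/-- `(G, X)` is a Shimura datum in the sense of Deligne: `G` is connected reductive over `ℚ`, `X` is
a `G(ℝ)`-conjugacy class of homomorphisms `S → G_ℝ`, and for `h ∈ X`
* `Lie(G)_ℂ` is of Hodge type `{(-1, 1), (0, 0), (1, -1)}`;
* `ad h(i)` is a Cartan involution of `G^ad_ℝ`;
* `G^ad` has no nontrivial quotient `G^ad / N` over `ℚ` (a factor of `G^ad`) in which `h` becomes
  trivial, i.e. such that `h^ad` factors through `N_ℝ`. -/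
structure IsShimuraDatum (X : Set (DeligneHom A)) : Prop where
  isConnectedReductive : IsConnectedReductive ℚ A
  isConjClass : ∃ h₀, X = {h | ∃ g : A →ₐ[ℚ] ℝ, DeligneHom.IsConjugate g h₀ h}
  hodgeType : ∀ h ∈ X, ∀ D ∈ lieAlgebra A, ∃ D₁ D₀ D₂ : A →ₗ[ℚ] ℂ,
    HasHodgeType h (-1) D₁ ∧ HasHodgeType h 0 D₀ ∧ HasHodgeType h 1 D₂ ∧ D = D₁ + D₀ + D₂
  cartan : ∀ h ∈ X, IsCompact (compactForm (h.ad.point (Units.mk0 Complex.I Complex.I_ne_zero)))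
  noFactor : ∀ h ∈ X, ∀ (N : Ideal (AdjointRing ℚ A)) [N.IsHopfIdeal ℚ],
    IsNormal ℚ N → (∀ a ∈ N, h.ad (1 ⊗ₜ a) = 0) → N = ⊥

/-- `x ∈ X_M` is Hodge generic: the Mumford-Tate group of `x^ad` is all of `M^ad`. For a point of a
Shimura datum this says that the Mumford-Tate group of `x` contains the derived group of `M`, or that
`x` lies in no special subvariety smaller than the connected component of `X_M` containing it. It
holds in particular if the Mumford-Tate group of `x` is `M`. -/
def IsHodgeGeneric (x : DeligneHom A) : Prop := x.ad.mtIdeal = ⊥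

variable {B : Type v} [CommRing B] [HopfAlgebra ℚ B]

/-- The hybrid Hecke orbit `Σ_X(M, X_M, x)`: the `x' ∈ X` for which there is a homomorphism
`φ : M^ad → M_{x'}^ad` over `ℚ` with `φ ∘ x^ad = x'^ad`, where `M_{x'}` is the Mumford-Tate group
of `x'`. -/
def hybridHeckeOrbit (X : Set (DeligneHom B)) (x : DeligneHom A) : Set (DeligneHom B) :=
  {x' ∈ X | ∃ φ : AdjointRing ℚ x'.MumfordTate →ₐc[ℚ] AdjointRing ℚ A,
    x.ad.map φ = x'.toMumfordTate.ad}

/-- `X₁ × X₂` as a set of homomorphisms `S → (G₁ × G₂)_ℝ`. -/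
def prodDatum {A₁ : Type u} [CommRing A₁] [HopfAlgebra ℚ A₁]
    {A₂ : Type v} [CommRing A₂] [HopfAlgebra ℚ A₂]
    (X₁ : Set (DeligneHom A₁)) (X₂ : Set (DeligneHom A₂)) : Set (DeligneHom (A₁ ⊗[ℚ] A₂)) :=
  DeligneHom.prodEquiv ⁻¹' (X₁ ×ˢ X₂)

end ShimuraDatum

end Shimura

end

noncomputable section
namespace Shimura

/-! ### Hopf ideals under homomorphisms: images and preimages of closed subgroups -/

section HopfIdeal

open WithConv Coalgebra

variable {k : Type w} [Field k] {A : Type u} [CommRing A] [HopfAlgebra k A]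
  {B : Type v} [CommRing B] [HopfAlgebra k B]

/-! Mumford-Tate groups are compatible with homomorphisms: `φ` maps `M_h` onto `M_{φ ∘ h}`
(`DeligneHom.mtIdeal_map`). So for `x' = (x₁, x₂)` the group `M_{x'}` is a closed subgroup of
`M_{x₁} × M_{x₂}` that surjects onto both factors. A surjection carries centre into centre, hence
induces a map of adjoint groups (`adjointMap`). Composing `M^ad → M_{x'}^ad` with `M_{x'}^ad →
M_{xᵢ}^ad` gives the inclusion from left to right (`AdjointDominates.map`).

Conversely, let `φᵢ : M^ad → M_{xᵢ}^ad` carry `x^ad` to `xᵢ^ad`. Then `(φ₁, φ₂) ∘ x^ad = θ ∘ x'^ad`,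
where `θ : M_{x'}^ad → M_{x₁}^ad × M_{x₂}^ad` is induced by the projections. Since `x` is Hodge
generic and `x'^ad` has full Mumford-Tate group, `(φ₁, φ₂)` and `θ` have the same image, namely the
Mumford-Tate group of this common homomorphism. If `θ` is a closed immersion, then `(φ₁, φ₂)`
factors through it, and the factor is the required `φ` (`DeligneHom.exists_map_eq_of_surjective`).

The kernel of `θ` is trivial on points: a point of `M_{x'}` that dies in both `M_{xᵢ}^ad` has
central components (`isCentral_of_trivial_on_adjoint`), so it is central (`isCentral_of_comp`).
Passing from this to surjectivity of `θ` on coordinate rings is a descent statement along the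
quotient of `M_{x'}` by its centre (`surjective_of_adjoint_le_range`, resting on
`mem_range_of_isEqualized`). It is proved for a Hopf subalgebra that is a domain. The image of `θ`
qualifies, because its coordinate ring embeds in that of the connected group `M`. -/

lemma bialgHom_comul (φ : B →ₐc[k] A) (b : B) :
    comul (R := k) (φ b) = Algebra.TensorProduct.map (φ : B →ₐ[k] A) φ (comul (R := k) b) :=
  (CoalgHomClass.map_comp_comul_apply φ b).symm

/-- Both sides are inverse to `φ` in the convolution monoid, one from the left and one from the
right. -/
lemma bialgHom_antipode (φ : B →ₐc[k] A) (b : B) :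
    φ (HopfAlgebra.antipode k b) = HopfAlgebra.antipode k (φ b) := by
  have hl : toConv ((φ : B →ₐ[k] A).comp (HopfAlgebra.antipodeAlgHom k B)) *
      toConv (φ : B →ₐ[k] A) = 1 := toConv_comp_antipode_mul _
  have hr : toConv (φ : B →ₐ[k] A) *
      toConv ((HopfAlgebra.antipodeAlgHom k A).comp (φ : B →ₐ[k] A)) = 1 := by
    have h := AlgHom.convMul_comp_bialgHom_distrib (toConv (AlgHom.id k A))
      (toConv ((AlgHom.id k A).comp (HopfAlgebra.antipodeAlgHom k A))) φ
    rw [mul_toConv_comp_antipode] at h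
    apply WithConv.ofConv_injective
    refine h.symm.trans ?_
    ext b
    simp [AlgHom.convOne_def]
  exact congrArg (fun F : WithConv (B →ₐ[k] A) => F b) (left_inv_eq_right_inv hl hr)

/-- This is the ideal of the image under `φ` of a closed subgroup. `B ⧸ I.comap φ` embeds in `A ⧸
I`, and over a field the tensor square of this embedding is again injective, so the coideal
condition can be tested in `A ⧸ I`. -/
lemma isHopfIdeal_comap (φ : B →ₐc[k] A) (I : Ideal A) [I.IsHopfIdeal k] :
    (I.comap φ).IsHopfIdeal k where
  counit_eq_zero b hb := by
    have := Submodule.IsCoideal.counit_eq_zero (R := k) (I := I.restrictScalars k) hb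
    rwa [CoalgHomClass.counit_comp_apply] at this
  map_mkQ_comul_eq_zero b hb := by
    have h : Algebra.TensorProduct.map (Ideal.Quotient.mkₐ k I) (Ideal.Quotient.mkₐ k I)
        (comul (R := k) (φ b)) = 0 :=
      Submodule.IsCoideal.map_mkQ_comul_eq_zero (R := k) (I := I.restrictScalars k) hb
    let j : B ⧸ I.comap φ →ₐ[k] A ⧸ I := Ideal.quotientMapₐ I (φ : B →ₐ[k] A) le_rfl
    have hj : Function.Injective j := by
      rw [injective_iff_map_eq_zero]
      intro b hb
      obtain ⟨b, rfl⟩ := Ideal.Quotient.mk_surjective b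
      exact Ideal.Quotient.eq_zero_iff_mem.2 (Ideal.Quotient.eq_zero_iff_mem.1 hb : φ b ∈ I)
    have inj : Function.Injective (Algebra.TensorProduct.map j j) :=
      TensorProduct.map_injective_of_flat_flat j.toLinearMap j.toLinearMap hj hj
    have key : Algebra.TensorProduct.map (Ideal.Quotient.mkₐ k (I.comap φ))
        (Ideal.Quotient.mkₐ k (I.comap φ)) (comul (R := k) b) = 0 := inj <| by
      rw [map_zero, ← h, bialgHom_comul, ← AlgHom.comp_apply, ← AlgHom.comp_apply,
        ← Algebra.TensorProduct.map_comp, ← Algebra.TensorProduct.map_comp]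
      rfl
    exact key
  antipode_mem b hb := by
    change φ _ ∈ I
    rw [bialgHom_antipode]
    exact Ideal.IsHopfIdeal.antipode_mem hb

/-- This is the ideal of the preimage of a closed subgroup. Each condition says that `I.map φ` lies
in a certain ideal, so it suffices to test the generators `φ b`. -/
lemma isHopfIdeal_map (φ : B →ₐc[k] A) (I : Ideal B) [I.IsHopfIdeal k] :
    (I.map φ).IsHopfIdeal k where
  counit_eq_zero := by
    have : I.map φ ≤ RingHom.ker (Bialgebra.counitAlgHom k A) := by
      refine Ideal.map_le_iff_le_comap.2 fun b hb => ?_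
      have := Submodule.IsCoideal.counit_eq_zero (R := k) (I := I.restrictScalars k) hb
      simpa using this
    exact fun a ha => this ha
  map_mkQ_comul_eq_zero := by
    have : I.map φ ≤ RingHom.ker ((Algebra.TensorProduct.map (Ideal.Quotient.mkₐ k (I.map φ))
        (Ideal.Quotient.mkₐ k (I.map φ))).comp (Bialgebra.comulAlgHom k A)) := by
      refine Ideal.map_le_iff_le_comap.2 fun b hb => ?_
      have h : Algebra.TensorProduct.map (Ideal.Quotient.mkₐ k I) (Ideal.Quotient.mkₐ k I)
          (comul (R := k) b) = 0 :=
        Submodule.IsCoideal.map_mkQ_comul_eq_zero (R := k) (I := I.restrictScalars k) hb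
      let j : B ⧸ I →ₐ[k] A ⧸ I.map φ :=
        Ideal.quotientMapₐ _ (φ : B →ₐ[k] A) Ideal.le_comap_map
      have h' := congrArg (Algebra.TensorProduct.map j j) h
      rw [map_zero, ← AlgHom.comp_apply, ← Algebra.TensorProduct.map_comp] at h'
      rw [Ideal.mem_comap, RingHom.mem_ker, AlgHom.comp_apply, Bialgebra.comulAlgHom_apply,
        bialgHom_comul, ← AlgHom.comp_apply, ← Algebra.TensorProduct.map_comp]
      exact h'
    exact fun a ha => this ha
  antipode_mem := by
    have : I.map φ ≤ (I.map φ).comap (HopfAlgebra.antipodeAlgHom k A) := by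
      refine Ideal.map_le_iff_le_comap.2 fun b hb => ?_
      change HopfAlgebra.antipode k (φ b) ∈ I.map φ
      rw [← bialgHom_antipode]
      exact Ideal.mem_map_of_mem φ (Ideal.IsHopfIdeal.antipode_mem hb)
    exact fun a ha => this ha

/-- The bialgebra homomorphism from a quotient by a Hopf ideal. -/
def quotientLift (I : Ideal B) [I.IsHopfIdeal k] (φ : B →ₐc[k] A) (h : ∀ b ∈ I, φ b = 0) :
    B ⧸ I →ₐc[k] A :=
  .ofAlgHom (Ideal.Quotient.liftₐ I (φ : B →ₐ[k] A) h)
    (by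
      refine Ideal.Quotient.algHom_ext k ?_
      ext b
      change counit (R := k) (φ b) = _
      rw [CoalgHomClass.counit_comp_apply]
      rfl)
    (by
      refine Ideal.Quotient.algHom_ext k ?_
      ext b
      change Algebra.TensorProduct.map _ _ (Algebra.TensorProduct.map
        (Ideal.Quotient.mkₐ k I) (Ideal.Quotient.mkₐ k I) (comul (R := k) b)) =
          comul (R := k) (φ b)
      rw [← AlgHom.comp_apply, ← Algebra.TensorProduct.map_comp, bialgHom_comul]
      rfl)

@[simp] lemma quotientLift_mk (I : Ideal B) [I.IsHopfIdeal k] (φ : B →ₐc[k] A)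
    (h : ∀ b ∈ I, φ b = 0) (b : B) : quotientLift I φ h (Ideal.Quotient.mk I b) = φ b := rfl

lemma quotientLift_injective (I : Ideal B) [I.IsHopfIdeal k] (φ : B →ₐc[k] A)
    (h : ∀ b, b ∈ I ↔ φ b = 0) :
    Function.Injective (quotientLift I φ fun b => (h b).1) := by
  rw [injective_iff_map_eq_zero]
  intro b hb
  obtain ⟨b, rfl⟩ := Ideal.Quotient.mk_surjective b
  exact Ideal.Quotient.eq_zero_iff_mem.2 ((h b).2 hb)

end HopfIdeal

/-! ### Functoriality of Mumford-Tate groups -/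

namespace DeligneHom

variable {A : Type u} [CommRing A] [HopfAlgebra ℚ A] {B : Type v} [CommRing B] [HopfAlgebra ℚ B]
  {C : Type w} [CommRing C] [HopfAlgebra ℚ C]

lemma map_one_tmul (φ : B →ₐc[ℚ] A) (h : DeligneHom A) (b : B) :
    h.map φ (1 ⊗ₜ b) = h (1 ⊗ₜ φ b) := rfl

lemma ext_one_tmul {h h' : DeligneHom A} (e : ∀ a, h (1 ⊗ₜ a) = h' (1 ⊗ₜ a)) : h = h' :=
  restrict_injective (AlgHom.ext e)

lemma map_comp (φ : B →ₐc[ℚ] A) (ψ : C →ₐc[ℚ] B) (h : DeligneHom A) :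
    h.map (φ.comp ψ) = (h.map φ).map ψ :=
  ext_one_tmul fun _ => rfl

/-- The Mumford-Tate group of `φ ∘ h` is the image under `φ` of the Mumford-Tate group of `h`. -/
lemma mtIdeal_map (φ : B →ₐc[ℚ] A) (h : DeligneHom A) :
    (h.map φ).mtIdeal = h.mtIdeal.comap φ := by
  apply le_antisymm
  -- The preimage of `M_{φ ∘ h}` is a closed subgroup through which `h` factors, so it contains
  -- `M_h`.
  · refine Ideal.map_le_iff_le_comap.1 (le_sSup ⟨isHopfIdeal_map φ _, ?_⟩)
    have : (h.map φ).mtIdeal.map φ ≤ RingHom.ker h.restrict :=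
      Ideal.map_le_iff_le_comap.2 fun b hb => (h.map φ).mtIdeal_le_ker hb
    exact fun a ha => this ha
  -- The image of `M_h` is a closed subgroup through which `φ ∘ h` factors, so it contains `M_{φ ∘
  -- h}`.
  · exact le_sSup ⟨isHopfIdeal_comap φ _, fun b hb => h.mtIdeal_le_ker hb⟩

/-- Apply `mtIdeal_map` to the inclusion of `M_h` in `G`: the ideal sought pulls back to `h.mtIdeal`
itself, which is zero in the quotient. -/
lemma mtIdeal_toMumfordTate (h : DeligneHom A) : h.toMumfordTate.mtIdeal = ⊥ := by
  have e := mtIdeal_map (Bialgebra.Quotient.mkBialgHom h.mtIdeal) h.toMumfordTate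
  rw [map_toMumfordTate] at e
  rw [eq_bot_iff]
  intro a ha
  obtain ⟨a, rfl⟩ := Ideal.Quotient.mk_surjective a
  have : a ∈ h.mtIdeal := by rw [e]; exact ha
  exact Ideal.Quotient.eq_zero_iff_mem.2 this

/-- The homomorphism of Mumford-Tate groups induced by a homomorphism of groups. -/
def mumfordTateMap (φ : B →ₐc[ℚ] A) (h : DeligneHom A) :
    (h.map φ).MumfordTate →ₐc[ℚ] h.MumfordTate :=
  quotientLift _ ((Bialgebra.Quotient.mkBialgHom h.mtIdeal).comp φ) fun b hb => by
    rw [mtIdeal_map] at hb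
    exact Ideal.Quotient.eq_zero_iff_mem.2 hb

/-- Geometrically, `M_h` surjects onto `M_{φ ∘ h}`. This surjectivity is what makes the adjoint
groups functorial here. -/
lemma mumfordTateMap_injective (φ : B →ₐc[ℚ] A) (h : DeligneHom A) :
    Function.Injective (mumfordTateMap φ h) :=
  quotientLift_injective _ _ fun b => by
    rw [mtIdeal_map]
    exact (Ideal.Quotient.eq_zero_iff_mem (I := h.mtIdeal)).symm

lemma toMumfordTate_map_mumfordTateMap (φ : B →ₐc[ℚ] A) (h : DeligneHom A) :
    h.toMumfordTate.map (mumfordTateMap φ h) = (h.map φ).toMumfordTate := by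
  refine ext_one_tmul fun b => ?_
  obtain ⟨b, rfl⟩ := Ideal.Quotient.mk_surjective b
  have e := congrArg (fun F : DeligneHom A => F (1 ⊗ₜ φ b)) h.map_toMumfordTate
  have e' := congrArg (fun F : DeligneHom B => F (1 ⊗ₜ b)) (h.map φ).map_toMumfordTate
  exact e.trans e'.symm

end DeligneHom

/-! ### Central points and functoriality of the adjoint group -/

section AdjointFunctoriality

open WithConv Algebra.TensorProduct Coalgebra

variable {k : Type v} [Field k]

section

variable {A : Type u} [CommRing A] [HopfAlgebra k A]

lemma isCentral_iff {R : Type w} [CommRing R] [Algebra k R] {z : A →ₐ[k] R} :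
    IsCentral z ↔ ∀ a, z.toLinearMap.lTensor A (comul (R := k) a) =
      z.toLinearMap.lTensor A (TensorProduct.comm k A A (comul (R := k) a)) := by
  refine ⟨fun hz => hz.comul_eq, fun h => ?_⟩
  apply WithConv.ofConv_injective
  ext a
  exact (conv_left_right z a).trans ((h a).trans (conv_right_left z a).symm)

/-- The image of the conjugation morphism under a point `g` is `x ↦ g x g⁻¹`. -/
lemma map_comp_conjugation {R : Type w} [CommRing R] [Algebra k R] (g : A →ₐ[k] R) :
    toConv ((Algebra.TensorProduct.map (AlgHom.id k A) g).comp (conjugation k A)) =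
      toConv (includeRight.comp g) * toConv includeLeft *
        toConv ((includeRight.comp g).comp (HopfAlgebra.antipodeAlgHom k A)) := by
  apply WithConv.ofConv_injective
  change (Algebra.TensorProduct.map (AlgHom.id k A) g).comp (conjugation k A) = _
  rw [conjugation, AlgHom.comp_convMul_distrib, AlgHom.comp_convMul_distrib]
  congr 3
  congr 1
  · congr 1; ext a; simp

lemma apply_leftSlice {R : Type w} [CommRing R] [Algebra k R] (g : A →ₐ[k] R) (l : A →ₗ[k] k)
    (t : A ⊗[k] A) : g (TensorProduct.lid k A (l.rTensor A t)) =
      TensorProduct.lid k R (l.rTensor R (Algebra.TensorProduct.map (AlgHom.id k A) g t)) := by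
  induction t using TensorProduct.induction_on with
  | zero => simp
  | tmul x y => simp
  | add x y hx hy => simp only [map_add, hx, hy]

/-- If `w` commutes with `x`, then `g w x (g w)⁻¹ = g x g⁻¹`. -/
lemma conj_mul_of_commute {T : Type w} [CommRing T] [Algebra k T] {g w x p : A →ₐ[k] T}
    (hwx : toConv x * toConv w = toConv w * toConv x) (hp : toConv p = toConv g * toConv w) :
    toConv p * toConv x * toConv (p.comp (HopfAlgebra.antipodeAlgHom k A)) =
      toConv g * toConv x * toConv (g.comp (HopfAlgebra.antipodeAlgHom k A)) := by
  have h1 := mul_toConv_comp_antipode p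
  have h2 := toConv_comp_antipode_mul g
  rw [hp, mul_assoc] at h1
  -- Once `w` has been moved past `x`, the remaining factor `w p⁻¹` is a right inverse of `g`, hence
  -- equals `g⁻¹`.
  rw [hp, mul_assoc (toConv g), ← hwx, ← mul_assoc, mul_assoc _ (toConv w),
    left_inv_eq_right_inv h2 h1]

/-- The matrix coefficients of the conjugation action of `G` on `O(G)` are functions on `G^ad`. -/
lemma conjugation_slice_mem (a : A) (l : A →ₗ[k] k) :
    TensorProduct.lid k A (l.rTensor A (conjugation k A a)) ∈ adjointSubalgebra k A := by
  intro R _ _ z hz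
  -- The universal point multiplied by the central point `z`; conjugation by it is to be compared
  -- with conjugation by the universal point.
  let g : A →ₐ[k] A ⊗[k] R :=
    (toConv includeLeft * toConv (includeRight.comp z) : WithConv (A →ₐ[k] A ⊗[k] R)).ofConv
  have hgw : toConv ((includeRight : A ⊗[k] R →ₐ[k] A ⊗[k] (A ⊗[k] R)).comp g) =
      toConv ((includeRight : A ⊗[k] R →ₐ[k] A ⊗[k] (A ⊗[k] R)).comp includeLeft) *
      toConv ((includeRight : A ⊗[k] R →ₐ[k] A ⊗[k] (A ⊗[k] R)).comp (includeRight.comp z)) := by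
    apply WithConv.ofConv_injective
    exact AlgHom.comp_convMul_distrib
      (includeRight : A ⊗[k] R →ₐ[k] A ⊗[k] (A ⊗[k] R)) _ _
  have hwx : (toConv includeLeft : WithConv (A →ₐ[k] A ⊗[k] (A ⊗[k] R))) *
      toConv ((includeRight : A ⊗[k] R →ₐ[k] A ⊗[k] (A ⊗[k] R)).comp (includeRight.comp z)) =
      toConv ((includeRight : A ⊗[k] R →ₐ[k] A ⊗[k] (A ⊗[k] R)).comp (includeRight.comp z)) *
      toConv includeLeft := by
    -- Centrality of `z` is an identity over `A ⊗ R`; base change along `R → A ⊗ R` makes it one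
    -- over `A ⊗ (A ⊗ R)`, with the universal point as the conjugated element.
    have e := congrArg (fun F : WithConv (A →ₐ[k] A ⊗[k] R) =>
      (Algebra.TensorProduct.map (AlgHom.id k A)
        (includeRight : R →ₐ[k] A ⊗[k] R)).comp F.ofConv) hz
    simp only [AlgHom.comp_convMul_distrib] at e
    have e1 : (Algebra.TensorProduct.map (AlgHom.id k A)
        (includeRight : R →ₐ[k] A ⊗[k] R)).comp includeLeft =
        (includeLeft : A →ₐ[k] A ⊗[k] (A ⊗[k] R)) := by
      ext a; simp
    have e2 : (Algebra.TensorProduct.map (AlgHom.id k A)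
        (includeRight : R →ₐ[k] A ⊗[k] R)).comp (includeRight.comp z) =
        (includeRight : A ⊗[k] R →ₐ[k] A ⊗[k] (A ⊗[k] R)).comp (includeRight.comp z) := by
      ext a; simp
    simp only [e1, e2] at e
    exact WithConv.ofConv_injective e
  have key : (Algebra.TensorProduct.map (AlgHom.id k A) g).comp (conjugation k A) =
      (Algebra.TensorProduct.map (AlgHom.id k A) includeLeft).comp (conjugation k A) := by
    apply WithConv.toConv_injective
    rw [map_comp_conjugation, map_comp_conjugation]
    exact conj_mul_of_commute hwx hgw
  change g _ = _
  rw [apply_leftSlice]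
  refine (congrArg (fun t => TensorProduct.lid k _ (l.rTensor _ t))
    (AlgHom.congr_fun key a)).trans ?_
  exact (apply_leftSlice (includeLeft : A →ₐ[k] A ⊗[k] R) l (conjugation k A a)).symm

/-- A point of `G` which becomes trivial in `G^ad` is central. -/
lemma isCentral_of_trivial_on_adjoint {R : Type w} [CommRing R] [Algebra k R] (z : A →ₐ[k] R)
    (hz : ∀ f ∈ adjointSubalgebra k A, z f = algebraMap k R (counit (R := k) f)) :
    IsCentral z := by
  -- The identity point of `G`, conjugation by which is trivial.
  let e : A →ₐ[k] R := (Algebra.ofId k R).comp (Bialgebra.counitAlgHom k A)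
  have he1 : toConv (includeRight.comp e : A →ₐ[k] A ⊗[k] R) = 1 := by
    apply WithConv.ofConv_injective
    ext a
    simp [e, AlgHom.convOne_def, Algebra.ofId_apply]
  have he : toConv ((Algebra.TensorProduct.map (AlgHom.id k A) e).comp (conjugation k A)) =
      toConv includeLeft := by
    have h := mul_toConv_comp_antipode (includeRight.comp e : A →ₐ[k] A ⊗[k] R)
    rw [he1, one_mul] at h
    rw [map_comp_conjugation, h, he1, one_mul, mul_one]
  -- Conjugation by a point depends only on its values at the matrix coefficients of the conjugation
  -- action. These lie in `O(G^ad)`, where `z` and `e` agree.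
  have key : (Algebra.TensorProduct.map (AlgHom.id k A) z).comp (conjugation k A) =
      (Algebra.TensorProduct.map (AlgHom.id k A) e).comp (conjugation k A) := by
    ext a
    refine eq_of_leftSlice fun l => ?_
    rw [AlgHom.comp_apply, AlgHom.comp_apply, ← apply_leftSlice, ← apply_leftSlice]
    exact hz _ (conjugation_slice_mem a l)
  have h := map_comp_conjugation z
  rw [key, he] at h
  have hinv := toConv_comp_antipode_mul (includeRight.comp z : A →ₐ[k] A ⊗[k] R)
  change _ = _
  conv_lhs => rw [h]
  rw [mul_assoc, hinv, mul_one]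

end

variable {A B : Type u} [CommRing A] [HopfAlgebra k A] [CommRing B] [HopfAlgebra k B]

lemma map_lTensor_comp {R : Type w} [CommRing R] [Algebra k R] (φ : B →ₐc[k] A) (z : A →ₐ[k] R)
    (t : B ⊗[k] B) :
    Algebra.TensorProduct.map (φ : B →ₐ[k] A) (AlgHom.id k R)
        ((z.comp (φ : B →ₐ[k] A)).toLinearMap.lTensor B t) =
      z.toLinearMap.lTensor A (Algebra.TensorProduct.map (φ : B →ₐ[k] A) φ t) := by
  induction t using TensorProduct.induction_on with
  | zero => simp
  | tmul x y => simp
  | add x y hx hy => simp only [map_add, hx, hy]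

lemma map_comm (φ : B →ₐc[k] A) (t : B ⊗[k] B) :
    Algebra.TensorProduct.map (φ : B →ₐ[k] A) φ (TensorProduct.comm k B B t) =
      TensorProduct.comm k A A (Algebra.TensorProduct.map (φ : B →ₐ[k] A) φ t) := by
  induction t using TensorProduct.induction_on with
  | zero => simp
  | tmul x y => simp
  | add x y hx hy => simp only [map_add, hx, hy]

/-- A surjective homomorphism of groups (injective on coordinate rings) maps the centre to the
centre. -/
lemma IsCentral.comp_of_injective {R : Type w} [CommRing R] [Algebra k R] {φ : B →ₐc[k] A}
    (hφ : Function.Injective φ) {z : A →ₐ[k] R} (hz : IsCentral z) :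
    IsCentral (z.comp (φ : B →ₐ[k] A)) := by
  rw [isCentral_iff] at hz ⊢
  intro b
  -- Flatness over the field lets the identity in `B ⊗ R` be checked in `A ⊗ R`, where it is the
  -- centrality of `z`.
  have inj : Function.Injective
      (Algebra.TensorProduct.map (φ : B →ₐ[k] A) (AlgHom.id k R)) :=
    TensorProduct.map_injective_of_flat_flat (φ : B →ₐ[k] A).toLinearMap
      (AlgHom.id k R).toLinearMap hφ Function.injective_id
  apply inj
  rw [map_lTensor_comp, map_lTensor_comp, map_comm, ← bialgHom_comul, hz]

/-- A central point of the source maps to a central point of the target, under which `f` is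
invariant; so the pullback of `f` is invariant under the original point. -/
lemma map_mem_adjointSubalgebra {φ : B →ₐc[k] A} (hφ : Function.Injective φ) {f : B}
    (hf : f ∈ adjointSubalgebra k B) : φ f ∈ adjointSubalgebra k A := by
  rw [mem_adjointSubalgebra_iff] at hf ⊢
  intro R _ _ z hz
  have e := congrArg (Algebra.TensorProduct.map (φ : B →ₐ[k] A) (AlgHom.id k R))
    (hf R _ (hz.comp_of_injective hφ))
  rw [map_lTensor_comp, ← bialgHom_comul] at e
  simpa using e

/-- The homomorphism of adjoint groups induced by a surjective homomorphism. -/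
def adjointMap (φ : B →ₐc[k] A) (hφ : Function.Injective φ) :
    AdjointRing k B →ₐc[k] AdjointRing k A :=
  .ofAlgHom (((φ : B →ₐ[k] A).comp (adjointSubalgebra k B).val).codRestrict _
      fun f => map_mem_adjointSubalgebra hφ f.2)
    (by
      ext f
      exact CoalgHomClass.counit_comp_apply φ (f : B))
    (by
      ext f : 1
      apply tensor_val_injective
      rw [AlgHom.comp_apply, AlgHom.comp_apply, Bialgebra.comulAlgHom_apply,
        Bialgebra.comulAlgHom_apply, map_val_comul, ← AlgHom.comp_apply,
        ← Algebra.TensorProduct.map_comp]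
      refine Eq.trans ?_ (bialgHom_comul φ (f : B)).symm
      rw [← map_val_comul, ← AlgHom.comp_apply, ← Algebra.TensorProduct.map_comp]
      rfl)

lemma coe_adjointMap (φ : B →ₐc[k] A) (hφ : Function.Injective φ) (f : AdjointRing k B) :
    (adjointMap φ hφ f : A) = φ f := rfl

end AdjointFunctoriality

lemma DeligneHom.ad_map_adjointMap {A B : Type u} [CommRing A] [HopfAlgebra ℚ A] [CommRing B]
    [HopfAlgebra ℚ B] (φ : B →ₐc[ℚ] A) (hφ : Function.Injective φ) (h : DeligneHom A) :
    h.ad.map (adjointMap φ hφ) = (h.map φ).ad :=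
  DeligneHom.ext_one_tmul fun _ => rfl

/-! ### Descent of functions along a quotient of affine groups -/

section Descent

open Coalgebra

/-- If `e` were not a scalar, some functional would kill `1` but not `e`; applied to the left factor
it contradicts the hypothesis. -/
lemma mem_range_of_tmul_one_eq {K : Type v} [Field K] {R : Type u} [CommRing R] [Algebra K R]
    {e : R} (h : e ⊗ₜ[K] (1 : R) = 1 ⊗ₜ e) : e ∈ Set.range (algebraMap K R) := by
  rcases subsingleton_or_nontrivial R with _ | _
  · exact ⟨0, Subsingleton.elim _ _⟩
  by_contra he
  have hs : e ∉ Submodule.span K {(1 : R)} := by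
    rw [Submodule.mem_span_singleton]
    rintro ⟨c, hc⟩
    exact he ⟨c, by rw [← hc, Algebra.smul_def, mul_one]⟩
  obtain ⟨l, hl, hl'⟩ := Submodule.exists_le_ker_of_notMem hs
  have h1 : l 1 = 0 := hl' (Submodule.mem_span_singleton_self _)
  have h2 := congrArg (fun t => TensorProduct.lid K R (l.rTensor R t)) h
  simp [h1] at h2
  exact hl h2

/-- `f ∈ E` has the same image under any two homomorphisms out of `E` which agree on `B`. -/
def IsEqualized {k : Type v} [Field k] {B E : Type u} [CommRing B] [Algebra k B] [CommRing E]
    [Algebra k E] (ι : B →ₐ[k] E) (f : E) : Prop :=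
  ∀ (T : Type u) [CommRing T] [Algebra k T] (u v : E →ₐ[k] T), u.comp ι = v.comp ι → u f = v f

/-- The `k`-structure on `T` can be taken from `u`; then `v` is `k`-linear too, because the
constants come from `B`, where `u` and `v` agree. -/
lemma IsEqualized.ringHom_apply_eq {k : Type v} [Field k] {B E : Type u} [CommRing B]
    [Algebra k B] [CommRing E] [Algebra k E] {ι : B →ₐ[k] E} {f : E} (hf : IsEqualized ι f)
    {T : Type u} [CommRing T] (u v : E →+* T) (huv : ∀ b, u (ι b) = v (ι b)) : u f = v f := by
  let : Algebra k T := (u.comp (algebraMap k E)).toAlgebra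
  let u' : E →ₐ[k] T := { u with commutes' := fun _ => rfl }
  let v' : E →ₐ[k] T := { v with
    commutes' := fun c => by
      have := huv (algebraMap k B c)
      rw [ι.commutes] at this
      exact this.symm }
  exact hf T u' v' (AlgHom.ext huv)

/-- If an element of `E` has the same image under any two homomorphisms which agree on a
domain `B`, then it is a fraction of elements of `B`. -/
lemma exists_mul_eq_of_equalizer {k : Type v} [Field k] {B E : Type u} [CommRing B] [Algebra k B]
    [IsDomain B] [CommRing E] [Algebra k E] {ι : B →ₐ[k] E} {f : E}
    (hf : IsEqualized ι f) :
    ∃ s : B, s ≠ 0 ∧ ∃ b : B, ι s * f = ι b := by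
  let : Algebra B E := ι.toRingHom.toAlgebra
  let K := FractionRing B
  let EK := K ⊗[B] E
  -- The two maps from `E` to `T` agree on `B`, so `f ⊗ 1 = 1 ⊗ f` over the fraction field `K`,
  -- which forces the image of `f` into `K`.
  let T := EK ⊗[K] EK
  let j : E →+* EK := (Algebra.TensorProduct.includeRight : E →ₐ[B] EK).toRingHom
  let u₀ : E →+* T := (Algebra.TensorProduct.includeLeft : EK →ₐ[K] T).toRingHom.comp j
  let v₀ : E →+* T := (Algebra.TensorProduct.includeRight : EK →ₐ[K] T).toRingHom.comp j
  have hj : ∀ b : B, j (ι b) = algebraMap K EK (algebraMap B K b) := fun b =>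
    ((Algebra.TensorProduct.includeRight : E →ₐ[B] EK).commutes b).trans
      (IsScalarTower.algebraMap_apply B K EK b)
  have huv : ∀ b : B, u₀ (ι b) = v₀ (ι b) := fun b => by
    change (Algebra.TensorProduct.includeLeft : EK →ₐ[K] T) (j (ι b)) =
      (Algebra.TensorProduct.includeRight : EK →ₐ[K] T) (j (ι b))
    rw [hj]
    exact ((Algebra.TensorProduct.includeLeft : EK →ₐ[K] T).commutes _).trans
      ((Algebra.TensorProduct.includeRight : EK →ₐ[K] T).commutes _).symm
  have h := hf.ringHom_apply_eq (T := T) u₀ v₀ huv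
  obtain ⟨q, hq⟩ := mem_range_of_tmul_one_eq (K := K) (e := j f) h
  obtain ⟨b, s, hs, rfl⟩ := IsFractionRing.div_surjective (A := B) q
  have hs0 : algebraMap B K s ≠ 0 :=
    IsFractionRing.to_map_ne_zero_of_mem_nonZeroDivisors hs
  have e : j (ι s * f) = j (ι b) := by
    rw [map_mul, hj, hj, ← hq, ← map_mul, mul_div_cancel₀ _ hs0]
  have e' : TensorProduct.mk B K E 1 (ι s * f) = TensorProduct.mk B K E 1 (ι b) := e
  -- `K ⊗ E` is the localization of `E` at the nonzero elements of `B`, so equality there holds in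
  -- `E` up to one more denominator `c`.
  obtain ⟨c, hc⟩ := (IsLocalizedModule.eq_iff_exists (nonZeroDivisors B)
    (TensorProduct.mk B K E 1)).1 e'
  refine ⟨c * s, mul_ne_zero (nonZeroDivisors.coe_ne_zero c) (nonZeroDivisors.ne_zero hs),
    c * b, ?_⟩
  rw [map_mul, map_mul, mul_assoc]
  exact hc

/-! ### Slices of the comultiplication and translation-stable ideals -/

section Slice

variable {k : Type v} [Field k]

/-- Expand in a basis of `W`: the coefficients are the slices by coordinate functionals. Any
property stable under slicing thus passes to the left components of `t`. -/
lemma exists_eq_sum_slice {V W : Type u} [AddCommGroup V] [Module k V] [AddCommGroup W]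
    [Module k W] (t : V ⊗[k] W) :
    ∃ (κ : Type u) (s : Finset κ) (x : κ → V) (y : κ → W), t = ∑ i ∈ s, x i ⊗ₜ y i ∧
      ∀ i, ∃ l : W →ₗ[k] k, x i = TensorProduct.rid k V (l.lTensor V t) := by
  classical
  let b := Module.Basis.ofVectorSpace k W
  obtain ⟨c, rfl⟩ := TensorProduct.eq_repr_basis_right b t
  refine ⟨_, c.support, c, b, rfl, fun i => ⟨b.coord i, ?_⟩⟩
  simp [Finsupp.sum, Finsupp.single_apply]

variable {E : Type u} [CommRing E] [HopfAlgebra k E]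

lemma comul_rightSlice (l : E →ₗ[k] k) (f : E) :
    comul (R := k) (TensorProduct.rid k E (l.lTensor E (comul (R := k) f))) =
      ((TensorProduct.rid k E).toLinearMap ∘ₗ l.lTensor E ∘ₗ comul).lTensor E
        (comul (R := k) f) := by
  have h : ∀ t : E ⊗[k] E, comul (R := k) (TensorProduct.rid k E (l.lTensor E t)) =
      ((TensorProduct.rid k E).toLinearMap ∘ₗ l.lTensor E).lTensor E
        (TensorProduct.assoc k E E E ((comul (R := k)).rTensor E t)) := by
    intro t
    induction t using TensorProduct.induction_on with
    | zero => simp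
    | tmul x y =>
      simp only [LinearMap.rTensor_tmul, LinearMap.lTensor_tmul, TensorProduct.rid_tmul, map_smul]
      induction comul (R := k) x using TensorProduct.induction_on with
      | zero => simp
      | tmul x y => simp
      | add x y hx hy => simp only [map_add, hx, hy, TensorProduct.add_tmul, smul_add]
    | add x y hx hy => simp only [map_add, hx, hy]
  rw [h, Coalgebra.coassoc_apply, ← LinearMap.comp_apply, ← LinearMap.lTensor_comp]
  rfl

/-- A nonzero ideal of a Hopf algebra which is stable under translation is the unit ideal. -/
lemma ideal_eq_top_of_rightSlice_mem {I : Ideal E} (hI : I ≠ ⊥)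
    (h : ∀ b ∈ I, ∀ l : E →ₗ[k] k, TensorProduct.rid k E (l.lTensor E (comul (R := k) b)) ∈ I) :
    I = ⊤ := by
  obtain ⟨b, hb, hb0⟩ := Submodule.exists_mem_ne_zero_of_ne_bot hI
  obtain ⟨l, hl⟩ : ∃ l : E →ₗ[k] k, l b ≠ 0 := by
    by_contra! hl
    exact hb0 ((Module.forall_dual_apply_eq_zero_iff k b).1 hl)
  -- A translate of `b` lying in `I` and not vanishing at the identity: its counit is `l b ≠ 0`.
  let d := TensorProduct.rid k E (l.lTensor E (comul (R := k) b))
  have hd : counit (R := k) d = l b := by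
    have e : ∀ t : E ⊗[k] E, counit (R := k) (TensorProduct.rid k E (l.lTensor E t)) =
        l (TensorProduct.lid k E ((counit (R := k)).rTensor E t)) := by
      intro t
      induction t using TensorProduct.induction_on with
      | zero => simp
      | tmul x y => simp [mul_comm]
      | add x y hx hy => simp only [map_add, hx, hy]
    refine (e _).trans ?_
    simp
  obtain ⟨κ, s, x, y, hxy, hx⟩ := exists_eq_sum_slice (comul (R := k) d)
  -- In the identity `ε(d) = ∑ d₁ S(d₂)` every `d₁` is a slice of `d ∈ I`, so a nonzero constant
  -- lies in `I`.
  have key : algebraMap k E (l b) ∈ I := by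
    rw [← hd, ← HopfAlgebra.mul_antipode_lTensor_comul_apply, hxy, map_sum, map_sum]
    refine I.sum_mem fun i _ => ?_
    obtain ⟨m, hm⟩ := hx i
    rw [LinearMap.lTensor_tmul, LinearMap.mul'_apply, hm]
    exact I.mul_mem_right _ (h _ (h b hb l) m)
  exact I.eq_top_of_isUnit_mem key ((isUnit_iff_ne_zero.2 hl).map (algebraMap k E))

open WithConv Algebra.TensorProduct in
/-- The identity `∑ Δ(x₁) (1 ⊗ S(x₂)) = x ⊗ 1`. -/
lemma comul_mul_antipode {κ : Type*} (s : Finset κ) (x c : κ → E) (a : E)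
    (h : comul (R := k) a = ∑ i ∈ s, x i ⊗ₜ c i) :
    ∑ i ∈ s, comul (R := k) (x i) * (1 ⊗ₜ HopfAlgebra.antipode k (c i)) = a ⊗ₜ 1 := by
  have e0 : (toConv includeLeft * toConv includeRight : WithConv (E →ₐ[k] E ⊗[k] E)) =
      toConv (Bialgebra.comulAlgHom k E) := by
    apply WithConv.ofConv_injective
    ext a
    refine (conv_left_right (AlgHom.id k E) a).trans ?_
    simp
  have e1 : toConv (Bialgebra.comulAlgHom k E) *
      toConv ((includeRight : E →ₐ[k] E ⊗[k] E).comp (HopfAlgebra.antipodeAlgHom k E)) =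
      toConv includeLeft := by
    rw [← e0, mul_assoc, mul_toConv_comp_antipode, mul_one]
  have e2 := congrArg (fun F : WithConv (E →ₐ[k] E ⊗[k] E) => F a) e1
  simp only [AlgHom.convMul_apply, h, map_sum] at e2
  simpa using e2

end Slice

section

variable {k : Type v} [Field k] {B E : Type u} [CommRing B] [HopfAlgebra k B] [CommRing E]
  [HopfAlgebra k E]

/-- Translate `u` and `v` on the right by the universal point of the group of `E`. Over `T ⊗ E` they
still agree on the Hopf subalgebra, hence on `f`; applying `l` to the factor `E` gives the claim. -/
lemma IsEqualized.rightSlice {ι : B →ₐc[k] E} {f : E} (hf : IsEqualized (ι : B →ₐ[k] E) f)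
    (l : E →ₗ[k] k) : IsEqualized (ι : B →ₐ[k] E)
      (TensorProduct.rid k E (l.lTensor E (comul (R := k) f))) := by
  intro T _ _ u v huv
  have e : ∀ (w : E →ₐ[k] T) (t : E ⊗[k] E), w (TensorProduct.rid k E (l.lTensor E t)) =
      TensorProduct.rid k T (l.lTensor T
        (Algebra.TensorProduct.map w (AlgHom.id k E) t)) := by
    intro w t
    induction t using TensorProduct.induction_on with
    | zero => simp
    | tmul x y => simp
    | add x y hx hy => simp only [map_add, hx, hy]
  have h := hf (T ⊗[k] E)
    ((Algebra.TensorProduct.map u (AlgHom.id k E)).comp (Bialgebra.comulAlgHom k E))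
    ((Algebra.TensorProduct.map v (AlgHom.id k E)).comp (Bialgebra.comulAlgHom k E)) (by
      ext b
      have e : ∀ w : E →ₐ[k] T, Algebra.TensorProduct.map w (AlgHom.id k E)
          (comul (R := k) (ι b)) = Algebra.TensorProduct.map (w.comp (ι : B →ₐ[k] E))
            ((AlgHom.id k E).comp (ι : B →ₐ[k] E)) (comul (R := k) b) := by
        intro w
        rw [bialgHom_comul, Algebra.TensorProduct.map_comp, AlgHom.comp_apply]
      exact (e u).trans ((huv ▸ rfl : _ = _).trans (e v).symm))
  rw [e, e]
  exact congrArg (fun t => TensorProduct.rid k T (l.lTensor T t)) h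

/-- Descent along a quotient homomorphism of affine groups: if `B` is a Hopf subalgebra of `E` and
a domain, then `B` is the equalizer of all pairs of homomorphisms out of `E` agreeing on `B`. -/
theorem mem_range_of_isEqualized [IsDomain B] (ι : B →ₐc[k] E) (hι : Function.Injective ι) {f : E}
    (hf : IsEqualized (ι : B →ₐ[k] E) f) : f ∈ Set.range ι := by
  classical
  obtain ⟨κ, s, x, y, hxy, hx⟩ := exists_eq_sum_slice (comul (R := k) f)
  let R : Subalgebra k E := (ι : B →ₐ[k] E).range
  -- The ideal of common denominators in `B` of the slices `x i`. It is nonzero because each slice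
  -- is a fraction; translation stability will make it the unit ideal.
  let D : Ideal B :=
    { carrier := {b | ∀ i ∈ s, ι b * x i ∈ R}
      add_mem' := fun {a b} ha hb i hi => by
        rw [map_add, add_mul]; exact R.add_mem (ha i hi) (hb i hi)
      zero_mem' := fun i _ => by rw [map_zero, zero_mul]; exact R.zero_mem
      smul_mem' := fun c b hb i hi => by
        rw [smul_eq_mul, map_mul, mul_assoc]; exact R.mul_mem ⟨c, rfl⟩ (hb i hi) }
  have hfrac : ∀ i, ∃ a : B, a ≠ 0 ∧ ι a * x i ∈ R := by
    intro i
    obtain ⟨l, hl⟩ := hx i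
    obtain ⟨a, ha, b, hb⟩ := exists_mul_eq_of_equalizer (hf.rightSlice l)
    exact ⟨a, ha, b, by rw [hl]; exact hb.symm⟩
  choose a ha ha' using hfrac
  have hD : D ≠ ⊥ := by
    refine Submodule.ne_bot_iff _ |>.2 ⟨∏ i ∈ s, a i, ?_, Finset.prod_ne_zero_iff.2 fun i _ => ha i⟩
    intro i hi
    obtain ⟨c, hc⟩ := Finset.dvd_prod_of_mem a hi
    rw [hc, mul_comm (a i), map_mul, mul_assoc]
    exact R.mul_mem ⟨c, rfl⟩ (ha' i)
  -- By coassociativity the span of the `x i` is stable under translation.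
  have hcomul : ∀ j, ∃ c : κ → E, comul (R := k) (x j) = ∑ i ∈ s, x i ⊗ₜ c i := by
    intro j
    obtain ⟨l, hl⟩ := hx j
    refine ⟨fun i => TensorProduct.rid k E (l.lTensor E (comul (R := k) (y i))), ?_⟩
    rw [hl, comul_rightSlice, hxy, map_sum]
    rfl
  -- A linear retraction of `ι`, used to extend functionals from `B` to `E`.
  obtain ⟨p, hp⟩ := LinearMap.exists_leftInverse_of_injective
    (ι : B →ₐ[k] E).toLinearMap (LinearMap.ker_eq_bot.2 hι)
  have hp' : ∀ b, p (ι b) = b := LinearMap.congr_fun hp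
  have htop : D = ⊤ := by
    refine ideal_eq_top_of_rightSlice_mem (k := k) hD fun b hb l j hj => ?_
    obtain ⟨c, hc⟩ := hcomul j
    have h1 : ∀ t : B ⊗[k] B, ι (TensorProduct.rid k B (l.lTensor B t)) * x j =
        TensorProduct.rid k E ((l ∘ₗ p).lTensor E
          (Algebra.TensorProduct.map (ι : B →ₐ[k] E) ι t * (x j ⊗ₜ 1))) := by
      intro t
      induction t using TensorProduct.induction_on with
      | zero => simp
      | tmul x y => simp [hp']
      | add x y hx hy => simp only [map_add, add_mul, hx, hy]
    have h2 : ∀ (r : E) (t : B ⊗[k] B), TensorProduct.rid k E ((l ∘ₗ p).lTensor E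
          (Algebra.TensorProduct.map (ι : B →ₐ[k] E) ι t * (1 ⊗ₜ r))) ∈ R := by
      intro r t
      induction t using TensorProduct.induction_on with
      | zero => simp
      | tmul x y =>
        simp only [Algebra.TensorProduct.map_tmul, Algebra.TensorProduct.tmul_mul_tmul, mul_one,
          LinearMap.lTensor_tmul, TensorProduct.rid_tmul]
        exact R.smul_mem ⟨x, rfl⟩ _
      | add x y hx hy => simp only [map_add, add_mul]; exact R.add_mem hx hy
    -- Here `Δ(b) (x j ⊗ 1) = ∑ Δ(b x i) (1 ⊗ S(c i))`. Each `b x i` lies in `B`, so its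
    -- comultiplication lies in `B ⊗ B` and its slices lie in `B`.
    rw [h1, ← bialgHom_comul, ← comul_mul_antipode s x c (x j) hc, Finset.mul_sum, map_sum,
      map_sum]
    refine R.sum_mem fun i hi => ?_
    obtain ⟨b', hb'⟩ := hb i hi
    have hb'' : ι b' = ι b * x i := hb'
    rw [← mul_assoc, ← Bialgebra.comul_mul, ← hb'', bialgHom_comul]
    exact h2 _ _
  have hxR : ∀ i ∈ s, x i ∈ R := fun i hi => by
    have h1 : (1 : B) ∈ D := htop ▸ Submodule.mem_top
    simpa using h1 i hi
  -- The counit axiom recovers `f` as a combination of its slices.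
  have hfx : f = ∑ i ∈ s, counit (R := k) (y i) • x i := by
    have e : TensorProduct.rid k E ((counit (R := k)).lTensor E (comul (R := k) f)) = f := by
      simp
    rw [← e, hxy]
    simp
  have : f ∈ R := by
    rw [hfx]
    exact R.sum_mem fun i hi => R.smul_mem (hxR i hi) _
  exact this

end

end Descent

/-! ### The adjoint group of a subgroup of a product -/

section AdjointGeneration

open WithConv Algebra.TensorProduct Coalgebra

variable {k : Type v} [Field k]

section

variable {B₁ B₂ E : Type*} [CommRing B₁] [HopfAlgebra k B₁] [CommRing B₂] [HopfAlgebra k B₂]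
  [CommRing E] [HopfAlgebra k E]

/-- The homomorphism into a product with given components. -/
def bialgLift (φ₁ : B₁ →ₐc[k] E) (φ₂ : B₂ →ₐc[k] E) : B₁ ⊗[k] B₂ →ₐc[k] E :=
  (Bialgebra.mulBialgHom k E).comp (Bialgebra.TensorProduct.map φ₁ φ₂)

@[simp] lemma bialgLift_tmul (φ₁ : B₁ →ₐc[k] E) (φ₂ : B₂ →ₐc[k] E) (a : B₁) (b : B₂) :
    bialgLift φ₁ φ₂ (a ⊗ₜ b) = φ₁ a * φ₂ b := rfl

lemma algHom_ext_of_bialgLift_surjective {p₁ : B₁ →ₐc[k] E} {p₂ : B₂ →ₐc[k] E}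
    (hp : Function.Surjective (bialgLift p₁ p₂)) {T : Type*} [CommRing T] [Algebra k T]
    {F G : E →ₐ[k] T} (h₁ : ∀ a, F (p₁ a) = G (p₁ a)) (h₂ : ∀ b, F (p₂ b) = G (p₂ b)) :
    F = G := by
  ext e
  obtain ⟨t, rfl⟩ := hp e
  induction t using TensorProduct.induction_on with
  | zero => simp
  | tmul x y => rw [bialgLift_tmul, map_mul, map_mul, h₁, h₂]
  | add x y hx hy => simp only [map_add, hx, hy]

end

variable {B₁ B₂ E : Type u} [CommRing B₁] [HopfAlgebra k B₁] [CommRing B₂] [HopfAlgebra k B₂]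
  [CommRing E] [HopfAlgebra k E]

/-- Commutation with `z` can be tested one factor at a time: on functions pulled back along `p` it
is the centrality of the image of `z`. -/
lemma IsCentral.apply_eq {B : Type u} [CommRing B] [HopfAlgebra k B] {R : Type w} [CommRing R]
    [Algebra k R] {p : B →ₐc[k] E} {z : E →ₐ[k] R} (hz : IsCentral (z.comp (p : B →ₐ[k] E)))
    (b : B) :
    (toConv includeLeft * toConv (includeRight.comp z) : WithConv (E →ₐ[k] E ⊗[k] R)).ofConv
      (p b) = (toConv (includeRight.comp z) * toConv includeLeft :
        WithConv (E →ₐ[k] E ⊗[k] R)).ofConv (p b) := by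
  refine (conv_left_right z (p b)).trans (Eq.trans ?_ (conv_right_left z (p b)).symm)
  rw [bialgHom_comul, ← map_comm, ← map_lTensor_comp, ← map_lTensor_comp, hz.comul_eq]

/-- A point of a subgroup of `G₁ × G₂` is central if its components are central. -/
lemma isCentral_of_comp {p₁ : B₁ →ₐc[k] E} {p₂ : B₂ →ₐc[k] E}
    (hp : Function.Surjective (bialgLift p₁ p₂)) {R : Type w} [CommRing R] [Algebra k R]
    {z : E →ₐ[k] R} (h₁ : IsCentral (z.comp (p₁ : B₁ →ₐ[k] E)))
    (h₂ : IsCentral (z.comp (p₂ : B₂ →ₐ[k] E))) : IsCentral z :=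
  WithConv.ofConv_injective (algHom_ext_of_bialgLift_surjective hp h₁.apply_eq h₂.apply_eq)

/-- If two points `u, v` of `G` agree in `H^ad`, then the image of `u⁻¹ v` in `H` is central. -/
lemma isCentral_inv_mul_comp {B : Type u} [CommRing B] [HopfAlgebra k B] {T : Type w} [CommRing T]
    [Algebra k T] (p : B →ₐc[k] E) (u v : E →ₐ[k] T)
    (huv : ∀ f ∈ adjointSubalgebra k B, u (p f) = v (p f)) :
    IsCentral ((toConv (u.comp (HopfAlgebra.antipodeAlgHom k E)) * toConv v).ofConv.comp
      (p : B →ₐ[k] E)) := by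
  refine isCentral_of_trivial_on_adjoint _ fun f hf => ?_
  let q : AdjointRing k B →ₐc[k] E := p.comp (toAdjoint k B)
  have hq : v.comp (q : AdjointRing k B →ₐ[k] E) = u.comp (q : AdjointRing k B →ₐ[k] E) :=
    AlgHom.ext fun f => (huv f f.2).symm
  -- In `H^ad` the points `u⁻¹ v` and `u⁻¹ u` coincide, and the latter is trivial.
  have h1 := AlgHom.convMul_comp_bialgHom_distrib
    (toConv (u.comp (HopfAlgebra.antipodeAlgHom k E))) (toConv v) q
  have h2 := AlgHom.convMul_comp_bialgHom_distrib
    (toConv (u.comp (HopfAlgebra.antipodeAlgHom k E))) (toConv u) q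
  rw [toConv_comp_antipode_mul] at h2
  simp only at h1 h2
  rw [hq, ← h2] at h1
  refine (AlgHom.congr_fun h1 ⟨f, hf⟩).trans ?_
  change algebraMap k T (counit (R := k) (p f)) = _
  rw [CoalgHomClass.counit_comp_apply]

/-- If `G` is a subgroup of `G₁ × G₂` surjecting onto both factors, then a homomorphism from `G^ad`
with integral image through which both maps `G → Gᵢ^ad` factor is injective. -/
theorem surjective_of_adjoint_le_range {p₁ : B₁ →ₐc[k] E} {p₂ : B₂ →ₐc[k] E}
    (hp : Function.Surjective (bialgLift p₁ p₂)) {C : Type u} [CommRing C] [HopfAlgebra k C]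
    (θ : C →ₐc[k] AdjointRing k E) (hθ₁ : ∀ a ∈ adjointSubalgebra k B₁, ∃ c, (θ c : E) = p₁ a)
    (hθ₂ : ∀ a ∈ adjointSubalgebra k B₂, ∃ c, (θ c : E) = p₂ a) (I : Ideal C) [I.IsHopfIdeal k]
    [IsDomain (C ⧸ I)] (hI : ∀ c, c ∈ I ↔ θ c = 0) : Function.Surjective θ := by
  intro f
  let ι : C ⧸ I →ₐc[k] E := (toAdjoint k E).comp (quotientLift I θ fun c => (hI c).1)
  have hι : Function.Injective ι :=
    Subtype.val_injective.comp (quotientLift_injective I θ hI)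
  -- If `u` and `v` agree on the image of `θ`, then `w = u⁻¹ v` is central, so every function on the
  -- adjoint group takes equal values at `u` and at `u w = v`.
  have hf : IsEqualized (ι : C ⧸ I →ₐ[k] E) (f : E) := by
    intro T _ _ u v huv
    have huv' : ∀ c, u (θ c : E) = v (θ c : E) := fun c =>
      AlgHom.congr_fun huv (Ideal.Quotient.mk I c)
    let w : WithConv (E →ₐ[k] T) := toConv (u.comp (HopfAlgebra.antipodeAlgHom k E)) * toConv v
    have hw : IsCentral w.ofConv := by
      refine isCentral_of_comp hp (isCentral_inv_mul_comp p₁ u v fun a ha => ?_)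
        (isCentral_inv_mul_comp p₂ u v fun a ha => ?_)
      · obtain ⟨c, hc⟩ := hθ₁ a ha
        rw [← hc, huv']
      · obtain ⟨c, hc⟩ := hθ₂ a ha
        rw [← hc, huv']
    have e := congrArg (Algebra.TensorProduct.lift u (AlgHom.id k T) fun _ _ => Commute.all _ _)
      (f.2 T w.ofConv hw)
    -- Specializing the universal point to `u` turns its product with `w` into `u w = v`.
    have e1 : (Algebra.TensorProduct.lift u (AlgHom.id k T) fun _ _ => Commute.all _ _).comp
        (toConv includeLeft * toConv (includeRight.comp w.ofConv) :
          WithConv (E →ₐ[k] E ⊗[k] T)).ofConv = v := by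
      rw [AlgHom.comp_convMul_distrib]
      apply WithConv.toConv_injective
      have e2 : (Algebra.TensorProduct.lift u (AlgHom.id k T) fun _ _ => Commute.all _ _).comp
          includeLeft = u := by ext; simp
      have e3 : (Algebra.TensorProduct.lift u (AlgHom.id k T) fun _ _ => Commute.all _ _).comp
          (includeRight.comp w.ofConv) = w.ofConv := by ext; simp
      simp only
      rw [e2, e3]
      change toConv u * (_ * _) = _
      rw [← mul_assoc, mul_toConv_comp_antipode, one_mul]
    have e4 := (AlgHom.congr_fun e1 (f : E)).symm.trans e
    simpa using e4.symm
  obtain ⟨c, hc⟩ := mem_range_of_isEqualized ι hι hf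
  obtain ⟨c, rfl⟩ := Ideal.Quotient.mk_surjective c
  exact ⟨c, Subtype.val_injective hc⟩

end AdjointGeneration

/-! ### Combining the two homomorphisms and the hybrid Hecke orbit -/

section HybridHeckeOrbit

variable {A A₁ A₂ : Type u} [CommRing A] [HopfAlgebra ℚ A] [CommRing A₁] [HopfAlgebra ℚ A₁]
  [CommRing A₂] [HopfAlgebra ℚ A₂]

lemma IsConnectedReductive.isDomain {k : Type v} [Field k] {A : Type u} [CommRing A]
    [HopfAlgebra k A] (h : IsConnectedReductive k A) : IsDomain A :=
  have := h.connected
  Function.Injective.isDomain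
    (Algebra.TensorProduct.includeRight : A →ₐ[k] AlgebraicClosure k ⊗[k] A).toRingHom
    (Algebra.TensorProduct.includeRight_injective (algebraMap k (AlgebraicClosure k)).injective)

lemma DeligneHom.map_bialgLift_eq {C D : Type u} [CommRing C] [HopfAlgebra ℚ C] [CommRing D]
    [HopfAlgebra ℚ D] {h : DeligneHom C} {h' : DeligneHom D} {φ₁ : A₁ →ₐc[ℚ] C}
    {φ₂ : A₂ →ₐc[ℚ] C} {ψ₁ : A₁ →ₐc[ℚ] D} {ψ₂ : A₂ →ₐc[ℚ] D} (e₁ : h.map φ₁ = h'.map ψ₁)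
    (e₂ : h.map φ₂ = h'.map ψ₂) :
    h.map (B := A₁ ⊗[ℚ] A₂) (bialgLift φ₁ φ₂) = h'.map (B := A₁ ⊗[ℚ] A₂) (bialgLift ψ₁ ψ₂) := by
  refine ext_one_tmul fun t => ?_
  have e₁' : ∀ a, h.restrict (φ₁ a) = h'.restrict (ψ₁ a) := fun a =>
    congrArg (fun F : DeligneHom A₁ => F (1 ⊗ₜ a)) e₁
  have e₂' : ∀ a, h.restrict (φ₂ a) = h'.restrict (ψ₂ a) := fun a =>
    congrArg (fun F : DeligneHom A₂ => F (1 ⊗ₜ a)) e₂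
  change h.restrict (bialgLift φ₁ φ₂ t) = h'.restrict (bialgLift ψ₁ ψ₂ t)
  induction t using TensorProduct.induction_on with
  | zero => simp only [map_zero]
  | tmul x y => rw [bialgLift_tmul, bialgLift_tmul, map_mul, map_mul, e₁', e₂']
  | add x y hx hy => simp only [map_add, hx, hy]

/-- `G → G^ad` carries the Mumford-Tate group `G` of `h` onto that of `h^ad`, and it is injective on
coordinate rings. -/
lemma DeligneHom.mtIdeal_ad {h : DeligneHom A} (hh : h.mtIdeal = ⊥) : h.ad.mtIdeal = ⊥ := by
  rw [ad, mtIdeal_map, hh]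
  exact (RingHom.injective_iff_ker_eq_bot (toAdjoint ℚ A).toAlgHom.toRingHom).1
    Subtype.val_injective

/-- There is a homomorphism `φ : M^ad → M_{x'}^ad` with `φ ∘ x^ad = x'^ad`. -/
def AdjointDominates {B : Type u} [CommRing B] [HopfAlgebra ℚ B] (x : DeligneHom A)
    (x' : DeligneHom B) : Prop :=
  ∃ φ : AdjointRing ℚ x'.MumfordTate →ₐc[ℚ] AdjointRing ℚ A, x.ad.map φ = x'.toMumfordTate.ad

/-- The Mumford-Tate group of `x'` surjects onto that of its image, so the adjoint groups map as
well and the given `φ` can be composed with this map. -/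
lemma AdjointDominates.map {B C : Type u} [CommRing B] [HopfAlgebra ℚ B] [CommRing C]
    [HopfAlgebra ℚ C] {x : DeligneHom A} {x' : DeligneHom C} (h : AdjointDominates x x')
    (π : B →ₐc[ℚ] C) : AdjointDominates x (x'.map π) := by
  obtain ⟨φ, hφ⟩ := h
  refine ⟨φ.comp (adjointMap _ (DeligneHom.mumfordTateMap_injective π x')), ?_⟩
  rw [DeligneHom.map_comp, hφ, DeligneHom.ad_map_adjointMap,
    DeligneHom.toMumfordTate_map_mumfordTateMap]

/-- When the Mumford-Tate group of `h` is everything, that of the composite is the whole image of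
the homomorphism, whose ideal is the kernel of `ψ`. -/
lemma DeligneHom.mem_mtIdeal_map_iff {C D : Type u} [CommRing C] [HopfAlgebra ℚ C] [CommRing D]
    [HopfAlgebra ℚ D] {h : DeligneHom D} (hh : h.mtIdeal = ⊥) (ψ : C →ₐc[ℚ] D) (c : C) :
    c ∈ (h.map ψ).mtIdeal ↔ ψ c = 0 := by
  rw [mtIdeal_map, hh]
  rfl

/-- If `ψ ∘ h = θ ∘ h'`, where `θ` is injective (surjective on coordinate rings) and the
Mumford-Tate group of `h` is the full group, then `ψ` factors through `θ`. -/
lemma DeligneHom.exists_map_eq_of_surjective {C D F : Type u} [CommRing C] [HopfAlgebra ℚ C]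
    [CommRing D] [HopfAlgebra ℚ D] [CommRing F] [HopfAlgebra ℚ F] {h : DeligneHom D}
    {h' : DeligneHom F} (hh : h.mtIdeal = ⊥) (hh' : h'.mtIdeal = ⊥) {ψ : C →ₐc[ℚ] D}
    {θ : C →ₐc[ℚ] F} (e : h.map ψ = h'.map θ) (hθ : Function.Surjective θ) :
    ∃ φ : F →ₐc[ℚ] D, h.map φ = h' := by
  have hψI := mem_mtIdeal_map_iff hh ψ
  have hθI := mem_mtIdeal_map_iff hh' θ
  -- Both kernels are now the ideal of the Mumford-Tate group of one and the same homomorphism, so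
  -- `ψ` and `θ` have the same kernel.
  rw [← e] at hθI
  let I := (h.map ψ).mtIdeal
  let q := BialgEquiv.ofBijective (quotientLift I θ fun c => (hθI c).1)
    ⟨quotientLift_injective I θ hθI, fun f => by
      obtain ⟨c, rfl⟩ := hθ f
      exact ⟨Ideal.Quotient.mk I c, rfl⟩⟩
  refine ⟨(quotientLift I ψ fun c => (hψI c).1).comp q.symm, ext_one_tmul fun f => ?_⟩
  obtain ⟨c, rfl⟩ := hθ f
  have hq : q.symm (θ c) = Ideal.Quotient.mk I c := q.symm_apply_apply (Ideal.Quotient.mk I c)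
  have h1 : (quotientLift I ψ fun c => (hψI c).1).comp q.symm (θ c) = ψ c := by
    change quotientLift I ψ (fun c => (hψI c).1) (q.symm (θ c)) = ψ c
    rw [hq, quotientLift_mk]
  rw [map_one_tmul, h1]
  exact congrArg (fun F : DeligneHom C => F (1 ⊗ₜ c)) e

/-- Let `x` be Hodge generic, and let `h` be a point of a subgroup of `G₁ × G₂` which surjects onto
both factors and is the Mumford-Tate group of `h`. If a homomorphism `ψ` maps `x^ad` to the image of
`h` in a group in which `h` has the same image as in `G₁^ad × G₂^ad`, then some homomorphism maps
`x^ad` to `h^ad`. -/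
lemma exists_adjoint_hom_of_cover [IsDomain A] {x : DeligneHom A} (hx : IsHodgeGeneric x)
    {B₁ B₂ E C : Type u} [CommRing B₁] [HopfAlgebra ℚ B₁] [CommRing B₂] [HopfAlgebra ℚ B₂]
    [CommRing E] [HopfAlgebra ℚ E] [CommRing C] [HopfAlgebra ℚ C] {h : DeligneHom E}
    (hh : h.mtIdeal = ⊥) {p₁ : B₁ →ₐc[ℚ] E} {p₂ : B₂ →ₐc[ℚ] E}
    (hp : Function.Surjective (bialgLift p₁ p₂)) (θ : C →ₐc[ℚ] AdjointRing ℚ E)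
    (ψ : C →ₐc[ℚ] AdjointRing ℚ A)
    (hθ₁ : ∀ a ∈ adjointSubalgebra ℚ B₁, ∃ c, (θ c : E) = p₁ a)
    (hθ₂ : ∀ a ∈ adjointSubalgebra ℚ B₂, ∃ c, (θ c : E) = p₂ a)
    (e : x.ad.map ψ = h.ad.map θ) :
    ∃ φ : AdjointRing ℚ E →ₐc[ℚ] AdjointRing ℚ A, x.ad.map φ = h.ad := by
  have had : h.ad.mtIdeal = ⊥ := DeligneHom.mtIdeal_ad hh
  have hψI := DeligneHom.mem_mtIdeal_map_iff hx ψ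
  have hθI := DeligneHom.mem_mtIdeal_map_iff had θ
  rw [← e] at hθI
  -- The quotient embeds through `ψ` in `O(M^ad) ⊆ O(M)`, a domain; this is the integrality needed
  -- for descent.
  have : IsDomain (C ⧸ (x.ad.map ψ).mtIdeal) :=
    Function.Injective.isDomain
      (quotientLift (x.ad.map ψ).mtIdeal ψ fun c => (hψI c).1).toAlgHom.toRingHom
      (quotientLift_injective _ ψ hψI)
  exact DeligneHom.exists_map_eq_of_surjective hx had e
    (surjective_of_adjoint_le_range hp θ hθ₁ hθ₂ _ hθI)

/-- Let `x` be Hodge generic, and let `h` be a point of a subgroup of `G₁ × G₂` which surjects onto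
both factors and is the Mumford-Tate group of `h`. Homomorphisms which map `x^ad` to the images of
`h` in `G₁^ad` and `G₂^ad` combine to a homomorphism which maps `x^ad` to `h^ad`. -/
lemma exists_adjoint_hom_of_factors [IsDomain A] {x : DeligneHom A} (hx : IsHodgeGeneric x)
    {B₁ B₂ E : Type u} [CommRing B₁] [HopfAlgebra ℚ B₁] [CommRing B₂] [HopfAlgebra ℚ B₂]
    [CommRing E] [HopfAlgebra ℚ E] {h : DeligneHom E} (hh : h.mtIdeal = ⊥) {p₁ : B₁ →ₐc[ℚ] E}
    {p₂ : B₂ →ₐc[ℚ] E} (hp : Function.Surjective (bialgLift p₁ p₂))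
    (hp₁ : Function.Injective p₁) (hp₂ : Function.Injective p₂)
    {φ₁ : AdjointRing ℚ B₁ →ₐc[ℚ] AdjointRing ℚ A} (hφ₁ : x.ad.map φ₁ = (h.map p₁).ad)
    {φ₂ : AdjointRing ℚ B₂ →ₐc[ℚ] AdjointRing ℚ A} (hφ₂ : x.ad.map φ₂ = (h.map p₂).ad) :
    ∃ φ : AdjointRing ℚ E →ₐc[ℚ] AdjointRing ℚ A, x.ad.map φ = h.ad := by
  refine exists_adjoint_hom_of_cover (C := AdjointRing ℚ B₁ ⊗[ℚ] AdjointRing ℚ B₂) hx hh hp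
    (bialgLift (adjointMap p₁ hp₁) (adjointMap p₂ hp₂)) (bialgLift φ₁ φ₂)
    (fun a ha => ⟨⟨a, ha⟩ ⊗ₜ 1, ?_⟩) (fun a ha => ⟨1 ⊗ₜ ⟨a, ha⟩, ?_⟩)
    (DeligneHom.map_bialgLift_eq ?_ ?_)
  · rw [bialgLift_tmul, map_one, mul_one, coe_adjointMap]
  · rw [bialgLift_tmul, map_one, one_mul, coe_adjointMap]
  · rw [hφ₁, DeligneHom.ad_map_adjointMap]
  · rw [hφ₂, DeligneHom.ad_map_adjointMap]

/-- A Hodge generic point dominates a point of a subgroup of `G₁ × G₂` if it dominates both of its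
components. -/
lemma AdjointDominates.of_components [IsDomain A] {x : DeligneHom A} (hx : IsHodgeGeneric x)
    {B : Type u} [CommRing B] [HopfAlgebra ℚ B] {π₁ : A₁ →ₐc[ℚ] B} {π₂ : A₂ →ₐc[ℚ] B}
    (hπ : Function.Surjective (bialgLift π₁ π₂)) {x' : DeligneHom B}
    (h₁ : AdjointDominates x (x'.map π₁)) (h₂ : AdjointDominates x (x'.map π₂)) :
    AdjointDominates x x' := by
  obtain ⟨φ₁, hφ₁⟩ := h₁
  obtain ⟨φ₂, hφ₂⟩ := h₂
  -- The Mumford-Tate group of `x'` is a closed subgroup of the product of those of its components,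
  -- because functions on the two factors generate those on the subgroup.
  have hp : Function.Surjective
      (bialgLift (DeligneHom.mumfordTateMap π₁ x') (DeligneHom.mumfordTateMap π₂ x')) := by
    intro e
    obtain ⟨b, rfl⟩ := Ideal.Quotient.mk_surjective e
    obtain ⟨t, rfl⟩ := hπ b
    induction t using TensorProduct.induction_on with
    | zero => exact ⟨0, by simp⟩
    | tmul a b =>
      refine ⟨Ideal.Quotient.mk _ a ⊗ₜ Ideal.Quotient.mk _ b, ?_⟩
      rw [bialgLift_tmul, bialgLift_tmul, map_mul]
      rfl
    | add s t hs ht =>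
      obtain ⟨c, hc⟩ := hs
      obtain ⟨d, hd⟩ := ht
      exact ⟨c + d, by rw [map_add, map_add, map_add, hc, hd]⟩
  refine exists_adjoint_hom_of_factors hx (DeligneHom.mtIdeal_toMumfordTate x') hp
    (DeligneHom.mumfordTateMap_injective π₁ x') (DeligneHom.mumfordTateMap_injective π₂ x')
    (φ₁ := φ₁) ?_ (φ₂ := φ₂) ?_
  · rw [hφ₁, DeligneHom.toMumfordTate_map_mumfordTateMap]
  · rw [hφ₂, DeligneHom.toMumfordTate_map_mumfordTateMap]

lemma bialgLift_fst_snd_surjective : Function.Surjective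
    (bialgLift (k := ℚ) (B₁ := A₁) (B₂ := A₂) (E := A₁ ⊗[ℚ] A₂) (DeligneHom.fst A₁ A₂)
      (DeligneHom.snd A₁ A₂)) := by
  intro t
  induction t using TensorProduct.induction_on with
  | zero => exact ⟨0, map_zero _⟩
  | tmul a b =>
    refine ⟨a ⊗ₜ b, ?_⟩
    rw [bialgLift_tmul]
    change (a ⊗ₜ[ℚ] (1 : A₂)) * ((1 : A₁) ⊗ₜ[ℚ] b) = _
    rw [Algebra.TensorProduct.tmul_mul_tmul, mul_one, one_mul]
  | add s t hs ht =>
    obtain ⟨c, hc⟩ := hs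
    obtain ⟨d, hd⟩ := ht
    exact ⟨c + d, by rw [map_add, hc, hd]⟩

end HybridHeckeOrbit
end Shimura
end

theorem mainTheorem10 {A A₁ A₂ : Type u}
    [CommRing A] [HopfAlgebra ℚ A]
    [CommRing A₁] [HopfAlgebra ℚ A₁]
    [CommRing A₂] [HopfAlgebra ℚ A₂]
    (X_M : Set (Shimura.DeligneHom A)) (hM : Shimura.IsShimuraDatum X_M)
    (X₁ : Set (Shimura.DeligneHom A₁)) (h₁ : Shimura.IsShimuraDatum X₁)
    (X₂ : Set (Shimura.DeligneHom A₂)) (h₂ : Shimura.IsShimuraDatum X₂)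
    (x : Shimura.DeligneHom A) (hx : x ∈ X_M) (hgen : Shimura.IsHodgeGeneric x) :
    Shimura.DeligneHom.prodEquiv ''
        Shimura.hybridHeckeOrbit (Shimura.prodDatum X₁ X₂) x =
      Shimura.hybridHeckeOrbit X₁ x ×ˢ Shimura.hybridHeckeOrbit X₂ x := by
  have := hM.isConnectedReductive.isDomain
  ext p
  -- The components of `prodEquiv x'` are by definition the composites of `x'` with the two
  -- projections, so the lemmas on `AdjointDominates` apply to them directly.
  obtain ⟨x', rfl⟩ := Shimura.DeligneHom.prodEquiv.surjective p
  rw [Shimura.DeligneHom.prodEquiv.injective.mem_set_image]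
  constructor
  · rintro ⟨hX, hφ⟩
    have hφ' : Shimura.AdjointDominates x x' := hφ
    exact ⟨⟨hX.1, hφ'.map (Shimura.DeligneHom.fst A₁ A₂)⟩,
      ⟨hX.2, hφ'.map (Shimura.DeligneHom.snd A₁ A₂)⟩⟩
  · rintro ⟨⟨hX₁, hφ₁⟩, ⟨hX₂, hφ₂⟩⟩
    exact ⟨⟨hX₁, hX₂⟩, Shimura.AdjointDominates.of_components hgen
      Shimura.bialgLift_fst_snd_surjective hφ₁ hφ₂⟩
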